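/- Let $(M,g)$ be a smooth Riemannian manifold (without boundary) of dimension $n$, let $f:M\to(0,\infty)$ be smooth, let $I\subseteq\mathbb R$ be a non-empty open interval and $\sigma:I\to(0,\infty)$ smooth, with $\dot\sigma=d\sigma/dt$. The doubly warped space-time ${}_fI\times_\sigma M$ is $\bar M=I\times M$ with the Lorentzian metric $\bar g=-f^2\,dt^2\oplus\sigma^2 g$. A semi-Riemannian manifold is called Ricci-symmetric (class $\mathcal P$) if its Ricci tensor is parallel with respect to its Levi-Civita connection. Let $D$ be the Levi-Civita connection of $g$, let $H^f$ be the Hessian of $f$ on $(M,g)$, and put $\mathcal F=\frac1f H^f$, a $(0,2)$ tensor field on $M$. Let $\sigma^\diamond=\sigma\,\Delta\sigma+(n-1)\,g_I(\nabla\sigma,\nabla\sigma)$, where the Laplacian $\Delta\sigma$ and the gradient $\nabla\sigma$ are taken on $I$ with the metric $g_I=-dt^2$ (so $\sigma^\diamond=-\sigma\ddot\sigma-(n-1)\dot\sigma^2$). Theorem. Suppose that the doubly warped space-time ${}_fI\times_\sigma M$ is Ricci-symmetric. Then $(M,g)$ is Ricci-symmetric if and only if $$(D_W\mathcal F)(U,V)=2\,\frac{\sigma^\diamond}{f^3}\,W(f)\,g(U,V)+\frac{(n-1)\,\dot\sigma^2}{f^3}\bigl(g(W,V)\,U(f)+g(W,U)\,V(f)\bigr)$$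 at every point of $I\times M$, for all tangent vectors $U,V,W$ of $M$. -/

import Mathlib

open scoped Manifold ContDiff

set_option maxSynthPendingDepth 3

noncomputable section

/-! ### Tensor calculus on an open subset of a vector space

Here `F` is a finite-dimensional real vector space, `G : F → F →L[ℝ] F →L[ℝ] ℝ` is (the coordinate
expression of) a semi-Riemannian metric near the point `y : F`, and tangent vectors at `y` are
elements of `F`. -/

namespace CoordGeom

variable {F : Type*} [NormedAddCommGroup F] [NormedSpace ℝ F]

/-- Swap the two arguments of a bilinear form, as a continuous linear operation. -/
def swap : (F →L[ℝ] F →L[ℝ] ℝ) →L[ℝ] (F →L[ℝ] F →L[ℝ] ℝ) :=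
  ((ContinuousLinearMap.flipₗᵢ ℝ F F ℝ).toContinuousLinearEquiv :
    (F →L[ℝ] F →L[ℝ] ℝ) →L[ℝ] (F →L[ℝ] F →L[ℝ] ℝ))

/-- Index raising: the inverse of `v ↦ G_y(v, ·)`. -/
def sharp (G : F → F →L[ℝ] F →L[ℝ] ℝ) (y : F) : (F →L[ℝ] ℝ) →L[ℝ] F :=
  (G y).inverse

/-- The Christoffel symbols of the first kind (doubled):
`(v, w, z) ↦ ∂_v G(w, z) + ∂_w G(v, z) - ∂_z G(v, w)`. -/
def koszul (G : F → F →L[ℝ] F →L[ℝ] ℝ) (y : F) : F →L[ℝ] F →L[ℝ] (F →L[ℝ] ℝ) :=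
  fderiv ℝ G y + (fderiv ℝ G y).flip - swap.comp (fderiv ℝ G y).flip

/-- The Christoffel symbols `Γ_y(v, w)` of the Levi-Civita connection of `G`, characterised by
`2 G(Γ(v, w), z) = ∂_v G(w, z) + ∂_w G(v, z) - ∂_z G(v, w)`. -/
def christoffel (G : F → F →L[ℝ] F →L[ℝ] ℝ) (y : F) : F →L[ℝ] F →L[ℝ] F :=
  (1 / 2 : ℝ) • (ContinuousLinearMap.compL ℝ F (F →L[ℝ] ℝ) F (sharp G y)).comp (koszul G y)

/-- The endomorphism `u ↦ R(u, v) w`, where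
`R(u, v) w = ∂_u Γ(v, w) - ∂_v Γ(u, w) + Γ(u, Γ(v, w)) - Γ(v, Γ(u, w))`. -/
def curvatureEnd (G : F → F →L[ℝ] F →L[ℝ] ℝ) (y v w : F) : F →L[ℝ] F :=
  ((fderiv ℝ (christoffel G) y).flip v).flip w
    - (fderiv ℝ (christoffel G) y v).flip w
    + (christoffel G y).flip (christoffel G y v w)
    - (christoffel G y v).comp ((christoffel G y).flip w)

/-- The Ricci tensor `Ric(v, w) = tr (u ↦ R(u, v) w)`. -/
def ricci (G : F → F →L[ℝ] F →L[ℝ] ℝ) (y v w : F) : ℝ :=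
  LinearMap.trace ℝ F (curvatureEnd G y v w : F →ₗ[ℝ] F)

/-- The covariant derivative `(D_w T)(u, v) = ∂_w (T(u, v)) - T(Γ(w, u), v) - T(u, Γ(w, v))` of a
`(0,2)` tensor field `T`, for the Levi-Civita connection of `G`. -/
def covDeriv (G : F → F →L[ℝ] F →L[ℝ] ℝ) (T : F → F → F → ℝ) (y w u v : F) : ℝ :=
  fderiv ℝ (fun x => T x u v) y w
    - T y (christoffel G y w u) v - T y u (christoffel G y w v)

/-- The Hessian `H^φ(v, w) = ∂_v ∂_w φ - (Γ(v, w)) φ`. -/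
def hessian (G : F → F →L[ℝ] F →L[ℝ] ℝ) (φ : F → ℝ) (y : F) : F →L[ℝ] F →L[ℝ] ℝ :=
  fderiv ℝ (fderiv ℝ φ) y
    - (ContinuousLinearMap.compL ℝ F F ℝ (fderiv ℝ φ y)).comp (christoffel G y)

/-- The gradient of `φ`. -/
def gradient (G : F → F →L[ℝ] F →L[ℝ] ℝ) (φ : F → ℝ) (y : F) : F :=
  sharp G y (fderiv ℝ φ y)

/-- The Laplacian of `φ`: the `G`-trace of its Hessian. -/
def laplacian (G : F → F →L[ℝ] F →L[ℝ] ℝ) (φ : F → ℝ) (y : F) : ℝ :=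
  LinearMap.trace ℝ F ((sharp G y).comp (hessian G φ y) : F →L[ℝ] F)

/-- `φ^◇ = φ Δφ + (m - 1) G(∇φ, ∇φ)`, where `m` is the dimension of the other factor. -/
def diamond (m : ℕ) (G : F → F →L[ℝ] F →L[ℝ] ℝ) (φ : F → ℝ) (y : F) : ℝ :=
  φ y * laplacian G φ y + ((m : ℝ) - 1) * G y (gradient G φ y) (gradient G φ y)

/-- The `(0,2)` tensor field `𝓕 = (m / φ) H^φ`, where `m` is the dimension of the other factor. -/
def warpHessian (m : ℕ) (G : F → F →L[ℝ] F →L[ℝ] ℝ) (φ : F → ℝ) (y u v : F) : ℝ :=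
  (m : ℝ) / φ y * hessian G φ y u v

end CoordGeom

/-! ### Fields of bilinear forms on a manifold -/

section Manifold

variable {F : Type*} [NormedAddCommGroup F] [NormedSpace ℝ F]
  {H : Type*} [TopologicalSpace H] (J : ModelWithCorners ℝ F H)
  {X : Type*} [TopologicalSpace X] [ChartedSpace H X]

/-- A (continuous) bilinear form on every tangent space of `X`. -/
abbrev BilinField (J : ModelWithCorners ℝ F H) (X : Type*) [TopologicalSpace X]
    [ChartedSpace H X] :=
  ∀ x : X, TangentSpace J x →L[ℝ] TangentSpace J x →L[ℝ] ℝ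

/-- Pull-back of a bilinear form `B` on `V` along a linear map `A : U → V`. -/
def pullbackForm {U V : Type*} [AddCommGroup U] [Module ℝ U] [TopologicalSpace U]
    [AddCommGroup V] [Module ℝ V] [TopologicalSpace V]
    (A : U →L[ℝ] V) (B : V →L[ℝ] V →L[ℝ] ℝ) : U →L[ℝ] U →L[ℝ] ℝ :=
  (ContinuousLinearMap.precomp ℝ A).comp (B.comp A)

/-- The coordinate expression of the field `g` in the chart `φ_p` of `X` at `p`: at a point `y` of
the target of the chart, it is the pull-back of `g` along the differential of `φ_p⁻¹` at `y`. -/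
def coordExpr (g : BilinField J X) (p : X) (y : F) : F →L[ℝ] F →L[ℝ] ℝ :=
  pullbackForm (mfderiv 𝓘(ℝ, F) J (extChartAt J p).symm y : F →L[ℝ] _)
    (g ((extChartAt J p).symm y))

/-- The coordinate expression of a function in the chart at `p`. -/
def coordFun (φ : X → ℝ) (p : X) (y : F) : ℝ :=
  φ ((extChartAt J p).symm y)

/-- Ricci-symmetry (class `𝒫`) of the manifold without boundary `X` with the metric `g`: the
covariant derivative of the Ricci tensor vanishes, i.e. in the chart at any point of `X` its
components vanish at every point of the chart. -/
def IsRicciSymmetric (g : BilinField J X) : Prop :=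
  ∀ p : X, ∀ y ∈ (extChartAt J p).target, ∀ w u v : F,
    CoordGeom.covDeriv (coordExpr J g p) (CoordGeom.ricci (coordExpr J g p)) y w u v = 0

/-- The function `φ^◇ = φ Δφ + (m - 1) g(∇φ, ∇φ)` on `X`, computed at `x` in the chart at `x`. -/
def warpDiamond (m : ℕ) (g : BilinField J X) (φ : X → ℝ) (x : X) : ℝ :=
  CoordGeom.diamond m (coordExpr J g x) (coordFun J φ x) (extChartAt J x x)

end Manifold

/-- The doubly warped metric `(f₂ ∘ π₂)² π₁^* g₁ ⊕ (f₁ ∘ π₁)² π₂^* g₂` on `X₁ × X₂`. -/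
def doublyWarped {F₁ F₂ : Type*} [NormedAddCommGroup F₁] [NormedSpace ℝ F₁]
    [NormedAddCommGroup F₂] [NormedSpace ℝ F₂] {H₁ H₂ : Type*} [TopologicalSpace H₁]
    [TopologicalSpace H₂] (J₁ : ModelWithCorners ℝ F₁ H₁) (J₂ : ModelWithCorners ℝ F₂ H₂)
    {X₁ X₂ : Type*} [TopologicalSpace X₁] [ChartedSpace H₁ X₁] [TopologicalSpace X₂]
    [ChartedSpace H₂ X₂] (g₁ : BilinField J₁ X₁) (g₂ : BilinField J₂ X₂)
    (f₁ : X₁ → ℝ) (f₂ : X₂ → ℝ) : BilinField (J₁.prod J₂) (X₁ × X₂) := fun x =>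
  f₂ x.2 ^ 2 • pullbackForm (mfderiv (J₁.prod J₂) J₁ Prod.fst x) (g₁ x.1)
    + f₁ x.1 ^ 2 • pullbackForm (mfderiv (J₁.prod J₂) J₂ Prod.snd x) (g₂ x.2)

/-- The metric `-dt²` on an open subset `I` of the line, `dt` being the differential of the
inclusion `t : I → ℝ`. -/
def minusDtSq (I : TopologicalSpace.Opens ℝ) : BilinField 𝓘(ℝ, ℝ) I := fun t =>
  -pullbackForm (mfderiv 𝓘(ℝ, ℝ) 𝓘(ℝ, ℝ) (Subtype.val : I → ℝ) t) (ContinuousLinearMap.mul ℝ ℝ)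

/-- The doubly warped space-time `_f I ×_σ M` with the metric `-f² dt² ⊕ σ² g`. -/
def doublyWarpedSpacetime {E : Type*} [NormedAddCommGroup E] [NormedSpace ℝ E] {M : Type*}
    [TopologicalSpace M] [ChartedSpace E M] (I : TopologicalSpace.Opens ℝ) (σ : ℝ → ℝ)
    (g : BilinField 𝓘(ℝ, E) M) (f : M → ℝ) :
    BilinField (𝓘(ℝ, ℝ).prod 𝓘(ℝ, E)) (I × M) :=
  doublyWarped 𝓘(ℝ, ℝ) 𝓘(ℝ, E) (minusDtSq I) g (fun t : I => σ t) f

end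

set_option linter.unusedSectionVars false

/-! In a chart the space-time metric is `lorentzWarped`. Computing its Christoffel symbols and Ricci
tensor shows that the purely spatial part of the parallel condition reads D_W Ric(U,V) = D_W 𝓕(U,V)
- 2 σ^◇/f³ W(f) g(U,V) + (n-1) σ̇²/f³ (g(W,V) U(f) + g(W,U) V(f)) (`covDeriv_ricci_space`). Hence D
Ric = 0 is equivalent to an equation for D𝓕 whose last term has the sign opposite to the one in the
theorem. The theorem holds nevertheless, by a dichotomy.

If (n-1) σ̇ df vanishes identically on I × M, the last term is zero, its sign is immaterial, and the
equivalence can be read off.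

Otherwise fix a time and a point with n ≥ 2, σ̇ ≠ 0 and df ≠ 0; then both sides of the equivalence
are false. The spatial identity at a fixed point of M but varying time forces σ^◇ and σ̇² to be
constant on I, so σ̈ = 0 and σ^◇ = -(n-1) σ̇² at that time. The time derivative of the spatial Ricci
components (`covDeriv_ricci_time`) then gives Ric = 𝓕 + σ^◇ g/f² - (n-1) df⊗df/f² (`ricci_eq`).
Inserting this into the spatial identity determines D(df⊗df/f²), and polarisation yields f H^f =
df⊗df - σ̇² g where df ≠ 0 (`hessian_eq`). So D𝓕 is explicit (`covDeriv_warpHessian_eq`). For U = V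
in the kernel of df the last term disappears with either sign, and each side of the equivalence
would give D_W 𝓕(U,U) = 2 σ^◇/f³ W(f) g(U,U); the explicit formula has σ̇² in place of σ^◇ = -(n-1)
σ̇², a contradiction since n σ̇² W(f) g(U,U) ≠ 0 for suitable W (`exists_covDeriv_warpHessian_ne`).
-/

namespace CoordGeom

/-! ### Component formulas, locality of the operators, bilinearity of the Ricci tensor. -/

section General

variable {F : Type*} [NormedAddCommGroup F] [NormedSpace ℝ F]

theorem koszul_apply (G : F → F →L[ℝ] F →L[ℝ] ℝ) (y v w z : F) :
    koszul G y v w z = fderiv ℝ G y v w z + fderiv ℝ G y w v z - fderiv ℝ G y z v w := rfl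

theorem christoffel_apply (G : F → F →L[ℝ] F →L[ℝ] ℝ) (y v w : F) :
    christoffel G y v w = (1 / 2 : ℝ) • sharp G y (koszul G y v w) := rfl

theorem curvatureEnd_apply (G : F → F →L[ℝ] F →L[ℝ] ℝ) (y u v w : F) :
    curvatureEnd G y v w u = fderiv ℝ (christoffel G) y u v w - fderiv ℝ (christoffel G) y v u w
      + christoffel G y u (christoffel G y v w) - christoffel G y v (christoffel G y u w) := rfl

theorem hessian_apply (G : F → F →L[ℝ] F →L[ℝ] ℝ) (φ : F → ℝ) (y u v : F) :
    hessian G φ y u v = fderiv ℝ (fderiv ℝ φ) y u v - fderiv ℝ φ y (christoffel G y u v) := rfl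

theorem fderiv_apply_apply {V A B C : Type*} [NormedAddCommGroup V] [NormedSpace ℝ V]
    [NormedAddCommGroup A] [NormedSpace ℝ A] [NormedAddCommGroup B] [NormedSpace ℝ B]
    [NormedAddCommGroup C] [NormedSpace ℝ C] {T : V → A →L[ℝ] B →L[ℝ] C} {y : V}
    (hT : DifferentiableAt ℝ T y) (w : V) (a : A) (b : B) :
    fderiv ℝ T y w a b = fderiv ℝ (fun x => T x a b) y w := by
  have h1 : HasFDerivAt (fun x => T x a b) _ y :=
    ((ContinuousLinearMap.apply ℝ C b).hasFDerivAt.comp y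
      (((ContinuousLinearMap.apply ℝ (B →L[ℝ] C) a).hasFDerivAt).comp y hT.hasFDerivAt))
  rw [h1.fderiv]
  rfl

section Congr

open Filter Topology

variable {G G' : F → F →L[ℝ] F →L[ℝ] ℝ} {y : F}

theorem christoffel_congr (h : G =ᶠ[𝓝 y] G') : christoffel G =ᶠ[𝓝 y] christoffel G' := by
  filter_upwards [h.eventuallyEq_nhds] with x hx
  unfold christoffel koszul sharp
  rw [hx.fderiv_eq, hx.eq_of_nhds]

theorem ricci_congr (h : G =ᶠ[𝓝 y] G') : ricci G =ᶠ[𝓝 y] ricci G' := by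
  filter_upwards [(christoffel_congr h).eventuallyEq_nhds] with x hx
  funext v w
  unfold ricci curvatureEnd
  rw [hx.fderiv_eq, hx.eq_of_nhds]

/-- Only germs at `y` matter. This allows a chart expression to be replaced by the model metric, and
a tensor field by a formula valid near `y`. -/
theorem covDeriv_congr (h : G =ᶠ[𝓝 y] G') {T T' : F → F → F → ℝ} (hT : T =ᶠ[𝓝 y] T') :
    covDeriv G T y = covDeriv G' T' y := by
  funext w u v
  unfold covDeriv
  rw [(christoffel_congr h).eq_of_nhds, hT.eq_of_nhds]
  congr 3
  refine Filter.EventuallyEq.fderiv_eq ?_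
  filter_upwards [hT] with x hx
  rw [hx]

theorem hessian_congr (h : G =ᶠ[𝓝 y] G') {φ ψ : F → ℝ} (hφ : φ =ᶠ[𝓝 y] ψ) :
    hessian G φ y = hessian G' ψ y := by
  unfold hessian
  rw [(christoffel_congr h).eq_of_nhds, hφ.fderiv.fderiv_eq, hφ.fderiv_eq]

theorem diamond_congr (m : ℕ) (h : G =ᶠ[𝓝 y] G') {φ ψ : F → ℝ} (hφ : φ =ᶠ[𝓝 y] ψ) :
    diamond m G φ y = diamond m G' ψ y := by
  unfold diamond laplacian gradient sharp
  rw [hessian_congr h hφ, h.eq_of_nhds, hφ.eq_of_nhds, hφ.fderiv_eq]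

end Congr

theorem ricci_add_left (G : F → F →L[ℝ] F →L[ℝ] ℝ) (y v v' w : F) :
    ricci G y (v + v') w = ricci G y v w + ricci G y v' w := by
  have : curvatureEnd G y (v + v') w = curvatureEnd G y v w + curvatureEnd G y v' w := by
    ext u
    simp only [curvatureEnd_apply, add_apply, map_add]
    abel
  simp [ricci, this]

theorem ricci_add_right (G : F → F →L[ℝ] F →L[ℝ] ℝ) (y v w w' : F) :
    ricci G y v (w + w') = ricci G y v w + ricci G y v w' := by
  have : curvatureEnd G y v (w + w') = curvatureEnd G y v w + curvatureEnd G y v w' := by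
    ext u
    simp only [curvatureEnd_apply, add_apply, map_add]
    abel
  simp [ricci, this]

theorem ricci_smul_left (G : F → F →L[ℝ] F →L[ℝ] ℝ) (y v w : F) (c : ℝ) :
    ricci G y (c • v) w = c * ricci G y v w := by
  have : curvatureEnd G y (c • v) w = c • curvatureEnd G y v w := by
    ext u
    simp only [curvatureEnd_apply, smul_apply, map_smul, smul_sub, smul_add]
  simp [ricci, this]

theorem ricci_smul_right (G : F → F →L[ℝ] F →L[ℝ] ℝ) (y v w : F) (c : ℝ) :
    ricci G y v (c • w) = c * ricci G y v w := by
  have : curvatureEnd G y v (c • w) = c • curvatureEnd G y v w := by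
    ext u
    simp only [curvatureEnd_apply, smul_apply, map_smul, smul_sub, smul_add]
  simp [ricci, this]

end General

/-! ### Levi-Civita calculus and smoothness for a semi-Riemannian metric on an open set. -/

section Metric

variable {F : Type*} [NormedAddCommGroup F] [NormedSpace ℝ F] [FiniteDimensional ℝ F]

theorem isInvertible_of_nondegenerate (B : F →L[ℝ] F →L[ℝ] ℝ)
    (hB : ∀ u, (∀ v, B u v = 0) → u = 0) : B.IsInvertible := by
  have hinj : Function.Injective (B : F →ₗ[ℝ] F →L[ℝ] ℝ) := by
    rw [injective_iff_map_eq_zero]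
    intro u hu
    exact hB u fun v => by
      have := congrArg (fun L : F →L[ℝ] ℝ => L v) hu
      simpa using this
  have hfin : FiniteDimensional ℝ (F →L[ℝ] ℝ) := inferInstance
  have hdim : Module.finrank ℝ F = Module.finrank ℝ (F →L[ℝ] ℝ) := by
    rw [← (LinearMap.toContinuousLinearMap (𝕜 := ℝ) (E := F) (F' := ℝ)).finrank_eq]
    exact (Subspace.dual_finrank_eq (K := ℝ) (V := F)).symm
  refine ⟨(LinearMap.linearEquivOfInjective _ hinj hdim).toContinuousLinearEquiv, ?_⟩
  ext u v
  rfl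

/-- `G` is a smooth semi-Riemannian metric on the open set `U`. -/
structure IsMetricOn (G : F → F →L[ℝ] F →L[ℝ] ℝ) (U : Set F) : Prop where
  isOpen : IsOpen U
  contDiffOn : ContDiffOn ℝ ∞ G U
  symm : ∀ y ∈ U, ∀ u v, G y u v = G y v u
  nondegenerate : ∀ y ∈ U, ∀ u, (∀ v, G y u v = 0) → u = 0

namespace IsMetricOn

variable {G : F → F →L[ℝ] F →L[ℝ] ℝ} {U : Set F} (hG : IsMetricOn G U) {y : F}

include hG

theorem mem_nhds (hy : y ∈ U) : U ∈ nhds y := hG.isOpen.mem_nhds hy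

theorem isInvertible (hy : y ∈ U) : (G y).IsInvertible :=
  isInvertible_of_nondegenerate _ (hG.nondegenerate y hy)

theorem contDiffAt (hy : y ∈ U) : ContDiffAt ℝ ∞ G y :=
  hG.contDiffOn.contDiffAt (hG.mem_nhds hy)

theorem differentiableAt (hy : y ∈ U) : DifferentiableAt ℝ G y :=
  (hG.contDiffAt hy).differentiableAt (by simp)

theorem sharp_apply (hy : y ∈ U) (v : F) : sharp G y (G y v) = v :=
  (hG.isInvertible hy).inverse_apply_self v

theorem apply_sharp (hy : y ∈ U) (L : F →L[ℝ] ℝ) : G y (sharp G y L) = L :=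
  (hG.isInvertible hy).self_apply_inverse L

theorem two_mul_apply_christoffel (hy : y ∈ U) (v w z : F) :
    2 * G y (christoffel G y v w) z = koszul G y v w z := by
  rw [christoffel_apply, map_smul, hG.apply_sharp hy, smul_apply, smul_eq_mul]
  ring

/-- By nondegeneracy the Koszul formula determines the Christoffel vector, so a guessed value needs
only to be tested against every `z`. -/
theorem christoffel_eq (hy : y ∈ U) {v w x : F} (h : ∀ z, 2 * G y x z = koszul G y v w z) :
    christoffel G y v w = x := by
  have : koszul G y v w = (2 : ℝ) • G y x := by
    ext z
    rw [← h z]; rfl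
  rw [christoffel_apply, this, map_smul, hG.sharp_apply hy, smul_smul]
  norm_num

theorem apply_gradient (hy : y ∈ U) (φ : F → ℝ) (v : F) :
    G y (gradient G φ y) v = fderiv ℝ φ y v := by
  rw [gradient, hG.apply_sharp hy]

theorem fderiv_symm (hy : y ∈ U) (w u v : F) :
    fderiv ℝ G y w u v = fderiv ℝ G y w v u := by
  rw [fderiv_apply_apply (hG.differentiableAt hy), fderiv_apply_apply (hG.differentiableAt hy)]
  congr 1
  refine Filter.EventuallyEq.fderiv_eq ?_
  filter_upwards [hG.mem_nhds hy] with x hx using hG.symm x hx u v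

theorem christoffel_symm (hy : y ∈ U) (v w : F) :
    christoffel G y v w = christoffel G y w v := by
  refine hG.christoffel_eq hy fun z => ?_
  rw [hG.two_mul_apply_christoffel hy, koszul_apply, koszul_apply, hG.fderiv_symm hy z v w]
  ring

/-- The Levi-Civita connection is metric. -/
theorem fderiv_eq (hy : y ∈ U) (w u v : F) :
    fderiv ℝ G y w u v = G y (christoffel G y w u) v + G y u (christoffel G y w v) := by
  have h1 := hG.two_mul_apply_christoffel hy w u v
  have h2 := hG.two_mul_apply_christoffel hy w v u
  rw [hG.symm y hy u]
  rw [koszul_apply] at h1 h2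
  linarith [hG.fderiv_symm hy w u v, hG.fderiv_symm hy u w v, hG.fderiv_symm hy v w u]

theorem contDiffAt_sharp (hy : y ∈ U) : ContDiffAt ℝ ∞ (sharp G) y := by
  have : CompleteSpace F := FiniteDimensional.complete ℝ F
  exact ((hG.isInvertible hy).contDiffAt_map_inverse).comp y (hG.contDiffAt hy)

theorem contDiffAt_koszul (hy : y ∈ U) : ContDiffAt ℝ ∞ (koszul G) y := by
  have h := (hG.contDiffAt hy).fderiv_right (m := ∞) (by simp)
  have hf := (ContinuousLinearMap.flipₗᵢ ℝ F F (F →L[ℝ] ℝ)).contDiff.contDiffAt.comp y h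
  have hs := ((ContinuousLinearMap.compL ℝ F (F →L[ℝ] F →L[ℝ] ℝ) (F →L[ℝ] F →L[ℝ] ℝ)
    swap).contDiff (n := ∞)).contDiffAt.comp y hf
  exact (h.add hf).sub hs

theorem contDiffAt_christoffel (hy : y ∈ U) : ContDiffAt ℝ ∞ (christoffel G) y := by
  have h1 := (ContinuousLinearMap.compL ℝ F (F →L[ℝ] ℝ) F).contDiff.contDiffAt.comp y
    (hG.contDiffAt_sharp hy)
  exact (h1.clm_comp (hG.contDiffAt_koszul hy)).const_smul (1 / 2 : ℝ)

theorem fderiv_christoffel (hy : y ∈ U) (u v w : F) :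
    fderiv ℝ (christoffel G) y u v w = fderiv ℝ (fun x => christoffel G x v w) y u :=
  fderiv_apply_apply ((hG.contDiffAt_christoffel hy).differentiableAt (by simp)) u v w

theorem contDiffAt_ricci (hy : y ∈ U) (v w : F) : ContDiffAt ℝ ∞ (fun x => ricci G x v w) y := by
  have hΓ := hG.contDiffAt_christoffel hy
  have hdΓ := hΓ.fderiv_right (m := ∞) (by simp)
  have flip' : ∀ {T : F → F →L[ℝ] F →L[ℝ] F}, ContDiffAt ℝ ∞ T y →
      ContDiffAt ℝ ∞ (fun x => (T x).flip) y := fun h =>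
    (ContinuousLinearMap.flipₗᵢ ℝ F F F).contDiff.contDiffAt.comp y h
  have h1 : ContDiffAt ℝ ∞ (fun x => curvatureEnd G x v w) y := by
    have a1 : ContDiffAt ℝ ∞ (fun x => ((fderiv ℝ (christoffel G) x).flip v)) y :=
      ((ContinuousLinearMap.flipₗᵢ ℝ F F (F →L[ℝ] F)).contDiff.contDiffAt.comp y hdΓ).clm_apply
        contDiffAt_const
    have a2 := (flip' a1).clm_apply (contDiffAt_const (c := w))
    have a3 := (flip' (hdΓ.clm_apply (contDiffAt_const (c := v)))).clm_apply
      (contDiffAt_const (c := w))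
    have a4 := (flip' hΓ).clm_apply
      ((hΓ.clm_apply (contDiffAt_const (c := v))).clm_apply (contDiffAt_const (c := w)))
    have a5 := (hΓ.clm_apply (contDiffAt_const (c := v))).clm_comp
      ((flip' hΓ).clm_apply (contDiffAt_const (c := w)))
    exact ((a2.sub a3).add a4).sub a5
  -- The trace is linear on a finite-dimensional space, hence smooth.
  exact (LinearMap.toContinuousLinearMap ((LinearMap.trace ℝ F).comp
    (ContinuousLinearMap.coeLM ℝ : (F →L[ℝ] F) →ₗ[ℝ] F →ₗ[ℝ] F))).contDiff.contDiffAt.comp y h1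

theorem contDiffAt_hessian (hy : y ∈ U) {φ : F → ℝ} (hφ : ContDiffAt ℝ ∞ φ y) :
    ContDiffAt ℝ ∞ (hessian G φ) y := by
  have h1 := hφ.fderiv_right (m := ∞) (by simp)
  have h2 := h1.fderiv_right (m := ∞) (by simp)
  have h3 := (ContinuousLinearMap.compL ℝ F F ℝ).contDiff.contDiffAt.comp y h1
  exact h2.sub (h3.clm_comp (hG.contDiffAt_christoffel hy))

end IsMetricOn

end Metric

end CoordGeom

/-- Write `T` as the sum of its compositions with the two projections and use cyclicity of the trace
on each. In the Ricci computations this separates the time entry from the space block. -/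
theorem LinearMap.trace_real_prod {E : Type*} [AddCommGroup E] [Module ℝ E]
    [FiniteDimensional ℝ E] (T : ℝ × E →ₗ[ℝ] ℝ × E) :
    LinearMap.trace ℝ (ℝ × E) T = (T (1, 0)).1
      + LinearMap.trace ℝ E (LinearMap.snd ℝ ℝ E ∘ₗ T ∘ₗ LinearMap.inr ℝ ℝ E) := by
  have h : T = LinearMap.inl ℝ ℝ E ∘ₗ (LinearMap.fst ℝ ℝ E ∘ₗ T)
      + LinearMap.inr ℝ ℝ E ∘ₗ (LinearMap.snd ℝ ℝ E ∘ₗ T) := by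
    ext <;> simp
  conv_lhs => rw [h, map_add, LinearMap.trace_comp_comm' _ (LinearMap.inl ℝ ℝ E),
    LinearMap.trace_comp_comm' _ (LinearMap.inr ℝ ℝ E)]
  congr 1
  have h1 : (LinearMap.fst ℝ ℝ E ∘ₗ T) ∘ₗ LinearMap.inl ℝ ℝ E
      = ((LinearMap.fst ℝ ℝ E ∘ₗ T) ∘ₗ LinearMap.inl ℝ ℝ E).smulRight (1 : ℝ) := by
    ext; simp
  rw [h1, LinearMap.trace_smulRight]
  rfl

namespace CoordGeom

/-! ### Derivatives of products with separated variables and of quotients; the model warped metric.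
-/

section Product

variable {E V : Type*} [NormedAddCommGroup E] [NormedSpace ℝ E] [NormedAddCommGroup V]
  [NormedSpace ℝ V] {α : ℝ → ℝ} {β : E → V} {s : ℝ} {y : E}

theorem differentiableAt_smul_prod (hα : DifferentiableAt ℝ α s) (hβ : DifferentiableAt ℝ β y) :
    DifferentiableAt ℝ (fun z : ℝ × E => α z.1 • β z.2) (s, y) :=
  (DifferentiableAt.comp (s, y) (g := α) hα differentiableAt_fst).smul
    (DifferentiableAt.comp (s, y) (g := β) hβ differentiableAt_snd)

theorem fderiv_smul_prod (hα : DifferentiableAt ℝ α s) (hβ : DifferentiableAt ℝ β y)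
    (r : ℝ) (u : E) :
    fderiv ℝ (fun z : ℝ × E => α z.1 • β z.2) (s, y) (r, u)
      = (r * deriv α s) • β y + α s • fderiv ℝ β y u := by
  have h1 : HasFDerivAt (fun z : ℝ × E => α z.1) _ (s, y) :=
    hα.hasFDerivAt.comp (s, y) (hasFDerivAt_fst (p := (s, y)))
  have h2 : HasFDerivAt (fun z : ℝ × E => β z.2) _ (s, y) :=
    hβ.hasFDerivAt.comp (s, y) (hasFDerivAt_snd (p := (s, y)))
  rw [(h1.fun_smul h2).fderiv]
  simp [add_comm]

theorem differentiableAt_mul_prod {β : E → ℝ} (hα : DifferentiableAt ℝ α s)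
    (hβ : DifferentiableAt ℝ β y) :
    DifferentiableAt ℝ (fun z : ℝ × E => α z.1 * β z.2) (s, y) :=
  differentiableAt_smul_prod hα hβ

theorem fderiv_mul_prod {β : E → ℝ} (hα : DifferentiableAt ℝ α s) (hβ : DifferentiableAt ℝ β y)
    (r : ℝ) (u : E) :
    fderiv ℝ (fun z : ℝ × E => α z.1 * β z.2) (s, y) (r, u)
      = r * deriv α s * β y + α s * fderiv ℝ β y u :=
  fderiv_smul_prod hα hβ r u

theorem hasFDerivAt_div {f g : E → ℝ} (hf : DifferentiableAt ℝ f y)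
    (hg : DifferentiableAt ℝ g y) (h0 : g y ≠ 0) :
    HasFDerivAt (fun x => f x / g x)
      ((g y)⁻¹ • fderiv ℝ f y - (f y / g y ^ 2) • fderiv ℝ g y) y := by
  have h1 := hf.hasFDerivAt.fun_mul ((hasDerivAt_inv h0).comp_hasFDerivAt y hg.hasFDerivAt)
  refine (h1.congr_fderiv ?_).congr_of_eventuallyEq (Filter.Eventually.of_forall fun x => ?_)
  · ext u
    simp
    ring
  · simp [div_eq_mul_inv]

theorem differentiableAt_div {f g : E → ℝ} (hf : DifferentiableAt ℝ f y)
    (hg : DifferentiableAt ℝ g y) (h0 : g y ≠ 0) : DifferentiableAt ℝ (fun x => f x / g x) y :=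
  (hasFDerivAt_div hf hg h0).differentiableAt

theorem fderiv_div_apply {f g : E → ℝ} (hf : DifferentiableAt ℝ f y)
    (hg : DifferentiableAt ℝ g y) (h0 : g y ≠ 0) (u : E) :
    fderiv ℝ (fun x => f x / g x) y u
      = fderiv ℝ f y u / g y - f y * fderiv ℝ g y u / g y ^ 2 := by
  rw [(hasFDerivAt_div hf hg h0).fderiv]
  simp
  ring

end Product

variable {E : Type*} [NormedAddCommGroup E] [NormedSpace ℝ E]

/-- The metric `-φ² dt² ⊕ σ² G` on an open subset of `ℝ × E`. -/
noncomputable def lorentzWarped (σ : ℝ → ℝ) (φ : E → ℝ) (G : E → E →L[ℝ] E →L[ℝ] ℝ)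
    (z : ℝ × E) : ℝ × E →L[ℝ] ℝ × E →L[ℝ] ℝ :=
  -(φ z.2 ^ 2 • pullbackForm (ContinuousLinearMap.fst ℝ ℝ E) (ContinuousLinearMap.mul ℝ ℝ))
    + σ z.1 ^ 2 • pullbackForm (ContinuousLinearMap.snd ℝ ℝ E) (G z.2)

theorem lorentzWarped_apply (σ : ℝ → ℝ) (φ : E → ℝ) (G : E → E →L[ℝ] E →L[ℝ] ℝ)
    (z a b : ℝ × E) :
    lorentzWarped σ φ G z a b = -(φ z.2 ^ 2 * (a.1 * b.1)) + σ z.1 ^ 2 * G z.2 a.2 b.2 := rfl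

variable [FiniteDimensional ℝ E]

/-- The data of a doubly warped product, in coordinates. -/
structure IsWarpedOn (σ : ℝ → ℝ) (I : Set ℝ) (φ : E → ℝ) (G : E → E →L[ℝ] E →L[ℝ] ℝ)
    (U : Set E) : Prop where
  isOpen_fst : IsOpen I
  contDiffOn_fst : ContDiffOn ℝ ∞ σ I
  ne_zero_fst : ∀ s ∈ I, σ s ≠ 0
  isMetricOn : IsMetricOn G U
  contDiffOn_snd : ContDiffOn ℝ ∞ φ U
  ne_zero_snd : ∀ y ∈ U, φ y ≠ 0

namespace IsWarpedOn

variable {σ : ℝ → ℝ} {I : Set ℝ} {φ : E → ℝ} {G : E → E →L[ℝ] E →L[ℝ] ℝ} {U : Set E}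
  (h : IsWarpedOn σ I φ G U) {s : ℝ} {y : E}

include h

theorem isMetricOn_lorentzWarped : IsMetricOn (lorentzWarped σ φ G) (I ×ˢ U) where
  isOpen := h.isOpen_fst.prod h.isMetricOn.isOpen
  contDiffOn := by
    refine contDiffOn_clm_apply.2 fun a => contDiffOn_clm_apply.2 fun b => ?_
    have h1 : ContDiffOn ℝ ∞ (fun z : ℝ × E => φ z.2) (I ×ˢ U) :=
      h.contDiffOn_snd.comp _root_.contDiffOn_snd fun z hz => hz.2
    have h2 : ContDiffOn ℝ ∞ (fun z : ℝ × E => σ z.1) (I ×ˢ U) :=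
      h.contDiffOn_fst.comp _root_.contDiffOn_fst fun z hz => hz.1
    have h3 : ContDiffOn ℝ ∞ (fun z : ℝ × E => G z.2) (I ×ˢ U) :=
      h.isMetricOn.contDiffOn.comp _root_.contDiffOn_snd fun z hz => hz.2
    exact (((h1.pow 2).mul contDiffOn_const).neg).add
      ((h2.pow 2).mul ((h3.clm_apply contDiffOn_const).clm_apply contDiffOn_const))
  symm := fun z hz a b => by
    rw [lorentzWarped_apply, lorentzWarped_apply, h.isMetricOn.symm _ hz.2, mul_comm a.1]
  nondegenerate := fun z hz a ha => by
    have h1 := ha (1, 0)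
    simp only [lorentzWarped_apply, map_zero, mul_zero, add_zero, mul_one, neg_eq_zero,
      mul_eq_zero, pow_eq_zero_iff, ne_eq, OfNat.ofNat_ne_zero, not_false_eq_true,
      h.ne_zero_snd _ hz.2, false_or] at h1
    refine Prod.ext h1 (h.isMetricOn.nondegenerate _ hz.2 _ fun v => ?_)
    have h2 := ha (0, v)
    simpa [lorentzWarped_apply, h.ne_zero_fst _ hz.1] using h2

theorem contDiffAt_fst (hs : s ∈ I) : ContDiffAt ℝ ∞ σ s :=
  h.contDiffOn_fst.contDiffAt (h.isOpen_fst.mem_nhds hs)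

theorem contDiffAt_deriv (hs : s ∈ I) : ContDiffAt ℝ ∞ (deriv σ) s := by
  have := (h.contDiffAt_fst hs).fderiv_right (m := ∞) (by simp)
  exact this.clm_apply contDiffAt_const

theorem contDiffAt_deriv_deriv (hs : s ∈ I) : ContDiffAt ℝ ∞ (deriv (deriv σ)) s := by
  have := (h.contDiffAt_deriv hs).fderiv_right (m := ∞) (by simp)
  exact this.clm_apply contDiffAt_const

theorem contDiffAt_snd (hy : y ∈ U) : ContDiffAt ℝ ∞ φ y :=
  h.contDiffOn_snd.contDiffAt (h.isMetricOn.mem_nhds hy)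

theorem differentiableAt_fst (hs : s ∈ I) : DifferentiableAt ℝ σ s :=
  (h.contDiffAt_fst hs).differentiableAt (by simp)

theorem differentiableAt_deriv (hs : s ∈ I) : DifferentiableAt ℝ (deriv σ) s :=
  (h.contDiffAt_deriv hs).differentiableAt (by simp)

theorem differentiableAt_snd (hy : y ∈ U) : DifferentiableAt ℝ φ y :=
  (h.contDiffAt_snd hy).differentiableAt (by simp)

theorem differentiableAt_fderiv (hy : y ∈ U) : DifferentiableAt ℝ (fderiv ℝ φ) y :=
  ((h.contDiffAt_snd hy).fderiv_right (m := ∞) (by simp)).differentiableAt (by simp)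

theorem differentiableAt_form (hy : y ∈ U) (v w : E) : DifferentiableAt ℝ (fun x => G x v w) y :=
  ((h.isMetricOn.differentiableAt hy).clm_apply (differentiableAt_const _)).clm_apply
    (differentiableAt_const _)

theorem fderiv_lorentzWarped (hs : s ∈ I) (hy : y ∈ U) (a b c : ℝ × E) :
    fderiv ℝ (lorentzWarped σ φ G) (s, y) a b c
      = -(2 * φ y * fderiv ℝ φ y a.2 * (b.1 * c.1))
        + (2 * σ s * deriv σ s * a.1 * G y b.2 c.2 + σ s ^ 2 * fderiv ℝ G y a.2 b.2 c.2) := by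
  rw [fderiv_apply_apply (h.isMetricOn_lorentzWarped.differentiableAt ⟨hs, hy⟩),
    fderiv_apply_apply (h.isMetricOn.differentiableAt hy)]
  have hσ := h.differentiableAt_fst hs
  have hφ := h.differentiableAt_snd hy
  have hG := h.differentiableAt_form hy b.2 c.2
  have hφ2 : DifferentiableAt ℝ (fun x => φ x ^ 2 * (b.1 * c.1)) y :=
    (hφ.pow 2).mul (differentiableAt_const _)
  have e : (fun z => lorentzWarped σ φ G z b c)
      = fun z : ℝ × E => (-1 : ℝ) * (φ z.2 ^ 2 * (b.1 * c.1)) + σ z.1 ^ 2 * G z.2 b.2 c.2 := by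
    funext z
    rw [lorentzWarped_apply]; ring
  obtain ⟨r, u⟩ := a
  rw [e, fderiv_fun_add (differentiableAt_mul_prod (α := fun _ => (-1 : ℝ))
      (differentiableAt_const _) hφ2)
    (differentiableAt_mul_prod (α := fun s => σ s ^ 2) (hσ.pow 2) hG), add_apply,
    fderiv_mul_prod (α := fun _ => (-1 : ℝ)) (differentiableAt_const _) hφ2,
    fderiv_mul_prod (α := fun s => σ s ^ 2) (hσ.pow 2) hG]
  have e1 : fderiv ℝ (fun x => φ x ^ 2 * (b.1 * c.1)) y u
      = 2 * φ y * fderiv ℝ φ y u * (b.1 * c.1) := by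
    rw [fderiv_mul_const (hφ.fun_pow 2), fderiv_fun_pow 2 hφ]
    simp
    ring
  have e2 : deriv (fun s => σ s ^ 2) s = 2 * σ s * deriv σ s := by
    rw [deriv_fun_pow hσ]; simp
  rw [e1, e2, deriv_const]
  ring

theorem christoffel_lorentzWarped (hs : s ∈ I) (hy : y ∈ U) (a b : ℝ × E) :
    christoffel (lorentzWarped σ φ G) (s, y) a b
      = ((a.1 * fderiv ℝ φ y b.2 + b.1 * fderiv ℝ φ y a.2) / φ y
          + σ s * deriv σ s / φ y ^ 2 * G y a.2 b.2,
        christoffel G y a.2 b.2 + (deriv σ s / σ s) • (a.1 • b.2 + b.1 • a.2)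
          + (a.1 * b.1 * φ y / σ s ^ 2) • gradient G φ y) := by
  refine h.isMetricOn_lorentzWarped.christoffel_eq ⟨hs, hy⟩ fun c => ?_
  have hσ := h.ne_zero_fst s hs
  have hφ := h.ne_zero_snd y hy
  rw [lorentzWarped_apply, koszul_apply]
  simp only [h.fderiv_lorentzWarped hs hy, map_add, map_smul, add_apply, smul_apply, smul_eq_mul,
    h.isMetricOn.apply_gradient hy]
  have h1 := h.isMetricOn.two_mul_apply_christoffel hy a.2 b.2 c.2
  rw [koszul_apply] at h1
  rw [h.isMetricOn.symm y hy a.2 c.2, h.isMetricOn.symm y hy b.2 c.2] at *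
  -- Eliminating one derivative of `G` through the Koszul formula turns the goal into an identity of
  -- rational functions.
  have h2 : fderiv ℝ G y a.2 b.2 c.2 = 2 * G y (christoffel G y a.2 b.2) c.2
    - fderiv ℝ G y b.2 a.2 c.2 + fderiv ℝ G y c.2 a.2 b.2 := by linarith
  rw [h2]
  field_simp
  ring

end IsWarpedOn

end CoordGeom

/-! ### The Ricci tensor of the doubly warped metric. -/

namespace CoordGeom

namespace IsWarpedOn

variable {E : Type*} [NormedAddCommGroup E] [NormedSpace ℝ E] [FiniteDimensional ℝ E]
  {σ : ℝ → ℝ} {I : Set ℝ} {φ : E → ℝ} {G : E → E →L[ℝ] E →L[ℝ] ℝ} {U : Set E}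
  (h : IsWarpedOn σ I φ G U) {s : ℝ} {y : E}

include h

theorem mem_nhds (hs : s ∈ I) (hy : y ∈ U) : I ×ˢ U ∈ nhds (s, y) :=
  h.isMetricOn_lorentzWarped.mem_nhds ⟨hs, hy⟩

/-- For the constant vectors needed, each component of the Christoffel symbol is a function of time
multiplied by a function of position, which reduces its derivative to the product rule. -/
theorem fderiv_christoffel_eq (hs : s ∈ I) (hy : y ∈ U) {a b : ℝ × E} {α₁ α₂ : ℝ → ℝ}
    {β₁ : E → ℝ} {β₂ : E → E} (hα₁ : DifferentiableAt ℝ α₁ s) (hα₂ : DifferentiableAt ℝ α₂ s)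
    (hβ₁ : DifferentiableAt ℝ β₁ y) (hβ₂ : DifferentiableAt ℝ β₂ y)
    (hab : ∀ s ∈ I, ∀ y ∈ U, christoffel (lorentzWarped σ φ G) (s, y) a b
      = (α₁ s * β₁ y, α₂ s • β₂ y)) (r : ℝ) (u : E) :
    fderiv ℝ (christoffel (lorentzWarped σ φ G)) (s, y) (r, u) a b
      = (r * deriv α₁ s * β₁ y + α₁ s * fderiv ℝ β₁ y u,
        (r * deriv α₂ s) • β₂ y + α₂ s • fderiv ℝ β₂ y u) := by
  rw [h.isMetricOn_lorentzWarped.fderiv_christoffel ⟨hs, hy⟩]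
  have e : (fun z => christoffel (lorentzWarped σ φ G) z a b)
      =ᶠ[nhds (s, y)] fun z : ℝ × E => (α₁ z.1 * β₁ z.2, α₂ z.1 • β₂ z.2) := by
    filter_upwards [h.mem_nhds hs hy] with z hz using hab z.1 hz.1 z.2 hz.2
  rw [e.fderiv_eq, (differentiableAt_mul_prod hα₁ hβ₁).fderiv_prodMk
    (differentiableAt_smul_prod hα₂ hβ₂), ContinuousLinearMap.prod_apply,
    fderiv_mul_prod hα₁ hβ₁, fderiv_smul_prod hα₂ hβ₂]

theorem deriv_mul_deriv (hs : s ∈ I) :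
    deriv (fun s => σ s * deriv σ s) s = deriv σ s ^ 2 + σ s * deriv (deriv σ) s := by
  rw [deriv_fun_mul (h.differentiableAt_fst hs) (h.differentiableAt_deriv hs)]
  ring

theorem fderiv_christoffel_space_space (hs : s ∈ I) (hy : y ∈ U) (r : ℝ) (u v w : E) :
    fderiv ℝ (christoffel (lorentzWarped σ φ G)) (s, y) (r, u) (0, v) (0, w)
      = (r * (deriv σ s ^ 2 + σ s * deriv (deriv σ) s) * (G y v w / φ y ^ 2)
          + σ s * deriv σ s * fderiv ℝ (fun x => G x v w / φ x ^ 2) y u,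
        fderiv ℝ (christoffel G) y u v w) := by
  have hφ := h.differentiableAt_snd hy
  have hΓ : DifferentiableAt ℝ (fun x => christoffel G x v w) y :=
    (((h.isMetricOn.contDiffAt_christoffel hy).clm_apply contDiffAt_const).clm_apply
      contDiffAt_const).differentiableAt (by simp)
  rw [h.fderiv_christoffel_eq hs hy (α₁ := fun s => σ s * deriv σ s) (α₂ := fun _ => (1 : ℝ))
      (β₁ := fun x => G x v w / φ x ^ 2) (β₂ := fun x => christoffel G x v w)
      ((h.differentiableAt_fst hs).mul (h.differentiableAt_deriv hs)) (differentiableAt_const _)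
      (differentiableAt_div (h.differentiableAt_form hy v w) (hφ.fun_pow 2)
        (pow_ne_zero 2 (h.ne_zero_snd y hy))) hΓ,
    h.deriv_mul_deriv hs, h.isMetricOn.fderiv_christoffel hy]
  · simp
  · intro s hs y hy
    rw [h.christoffel_lorentzWarped hs hy]
    ext
    · simp; ring
    · simp

theorem fderiv_christoffel_time_space (hs : s ∈ I) (hy : y ∈ U) (r : ℝ) (u w : E) :
    fderiv ℝ (christoffel (lorentzWarped σ φ G)) (s, y) (r, u) (1, 0) (0, w)
      = (fderiv ℝ (fderiv ℝ φ) y u w / φ y - fderiv ℝ φ y w * fderiv ℝ φ y u / φ y ^ 2,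
        (r * deriv (fun s => deriv σ s / σ s) s) • w) := by
  have hφ := h.differentiableAt_snd hy
  have hdφ : DifferentiableAt ℝ (fun x => fderiv ℝ φ x w) y :=
    (h.differentiableAt_fderiv hy).clm_apply (differentiableAt_const _)
  rw [h.fderiv_christoffel_eq hs hy (α₁ := fun _ => (1 : ℝ)) (α₂ := fun s => deriv σ s / σ s)
      (β₁ := fun x => fderiv ℝ φ x w / φ x) (β₂ := fun _ : E => w) (differentiableAt_const _)
      ((h.differentiableAt_deriv hs).div (h.differentiableAt_fst hs) (h.ne_zero_fst s hs))
      (differentiableAt_div hdφ hφ (h.ne_zero_snd y hy)) (differentiableAt_const _)]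
  · have h0 := h.ne_zero_snd y hy
    have e : fderiv ℝ (fun x => fderiv ℝ φ x w / φ x) y u
        = fderiv ℝ (fderiv ℝ φ) y u w / φ y - fderiv ℝ φ y w * fderiv ℝ φ y u / φ y ^ 2 := by
      rw [fderiv_div_apply hdφ hφ h0, fderiv_clm_apply (h.differentiableAt_fderiv hy)
        (differentiableAt_const _)]
      simp
    rw [e]
    simp
  · intro s hs y hy
    rw [h.christoffel_lorentzWarped hs hy]
    ext <;> simp

theorem fderiv_christoffel_symm (hs : s ∈ I) (hy : y ∈ U) (a b c : ℝ × E) :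
    fderiv ℝ (christoffel (lorentzWarped σ φ G)) (s, y) a b c
      = fderiv ℝ (christoffel (lorentzWarped σ φ G)) (s, y) a c b := by
  rw [h.isMetricOn_lorentzWarped.fderiv_christoffel ⟨hs, hy⟩,
    h.isMetricOn_lorentzWarped.fderiv_christoffel ⟨hs, hy⟩]
  congr 1
  refine Filter.EventuallyEq.fderiv_eq ?_
  filter_upwards [h.mem_nhds hs hy] with z hz
    using h.isMetricOn_lorentzWarped.christoffel_symm hz b c

/-- Only this component is required: the derivative of `Γ(∂_t, ∂_t)` enters the mixed Ricci
component solely through the time entry of the trace. The spatial part, which would involve the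
derivative of the gradient, never appears. -/
theorem fderiv_christoffel_time_time_fst (hs : s ∈ I) (hy : y ∈ U) (a : ℝ × E) :
    (fderiv ℝ (christoffel (lorentzWarped σ φ G)) (s, y) a (1, 0) (1, 0)).1 = 0 := by
  have hd : DifferentiableAt ℝ (fun z => christoffel (lorentzWarped σ φ G) z (1, 0) (1, 0))
      (s, y) :=
    (((h.isMetricOn_lorentzWarped.contDiffAt_christoffel ⟨hs, hy⟩).clm_apply
      contDiffAt_const).clm_apply contDiffAt_const).differentiableAt (by simp)
  rw [h.isMetricOn_lorentzWarped.fderiv_christoffel ⟨hs, hy⟩]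
  have e1 : (fderiv ℝ (fun z => christoffel (lorentzWarped σ φ G) z (1, 0) (1, 0)) (s, y) a).1
      = fderiv ℝ (fun z => (christoffel (lorentzWarped σ φ G) z (1, 0) (1, 0)).1) (s, y) a := by
    rw [hd.hasFDerivAt.fst.fderiv]
    rfl
  have e2 : (fun z => (christoffel (lorentzWarped σ φ G) z (1, 0) (1, 0)).1)
      =ᶠ[nhds (s, y)] fun _ => 0 := by
    filter_upwards [h.mem_nhds hs hy] with z hz
    obtain ⟨s, y⟩ := z
    rw [h.christoffel_lorentzWarped hz.1 hz.2]
    simp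
  rw [e1, e2.fderiv_eq]
  simp

/-- The space block of the curvature endomorphism is that of `G` plus a constant-curvature-type
term, whose trace gives the factor n - 1. The time entry contributes the Hessian and the `σ σ̈`
term. -/
theorem ricci_space_space (hs : s ∈ I) (hy : y ∈ U) (v w : E) :
    ricci (lorentzWarped σ φ G) (s, y) (0, v) (0, w)
      = ricci G y v w - hessian G φ y v w / φ y
        + (σ s * deriv (deriv σ) s + (Module.finrank ℝ E - 1) * deriv σ s ^ 2) / φ y ^ 2
          * G y v w := by
  have hσ := h.ne_zero_fst s hs
  have hφ := h.ne_zero_snd y hy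
  have e : LinearMap.snd ℝ ℝ E ∘ₗ (curvatureEnd (lorentzWarped σ φ G) (s, y) (0, v) (0, w) :
        ℝ × E →ₗ[ℝ] ℝ × E) ∘ₗ LinearMap.inr ℝ ℝ E
      = (curvatureEnd G y v w : E →ₗ[ℝ] E) + (deriv σ s ^ 2 / φ y ^ 2) •
        (G y v w • LinearMap.id - ((G y w : E →L[ℝ] ℝ) : E →ₗ[ℝ] ℝ).smulRight v) := by
    ext u
    simp only [LinearMap.comp_apply, LinearMap.inr_apply, LinearMap.snd_apply,
      ContinuousLinearMap.coe_coe, curvatureEnd_apply, h.fderiv_christoffel_space_space hs hy,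
      h.christoffel_lorentzWarped hs hy, LinearMap.add_apply, LinearMap.smul_apply,
      LinearMap.sub_apply, LinearMap.smulRight_apply, LinearMap.id_apply, Prod.snd_sub,
      Prod.snd_add, h.isMetricOn.symm y hy w u]
    simp
    match_scalars <;> field_simp
  rw [ricci, LinearMap.trace_real_prod, e]
  simp only [ContinuousLinearMap.coe_coe, curvatureEnd_apply,
    h.fderiv_christoffel_space_space hs hy, h.fderiv_christoffel_time_space hs hy,
      h.christoffel_lorentzWarped hs hy, map_add, map_smul, map_sub, LinearMap.trace_smulRight,
      LinearMap.trace_id, ricci, hessian_apply, Prod.fst_sub, Prod.fst_add]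
  simp [h.isMetricOn.symm y hy w v]
  field_simp
  ring

theorem ricci_time_space (hs : s ∈ I) (hy : y ∈ U) (w : E) :
    ricci (lorentzWarped σ φ G) (s, y) (1, 0) (0, w)
      = (Module.finrank ℝ E - 1) * deriv σ s / (σ s * φ y) * fderiv ℝ φ y w := by
  have hσ := h.ne_zero_fst s hs
  have hφ := h.ne_zero_snd y hy
  have e : LinearMap.snd ℝ ℝ E ∘ₗ (curvatureEnd (lorentzWarped σ φ G) (s, y) (1, 0) (0, w) :
        ℝ × E →ₗ[ℝ] ℝ × E) ∘ₗ LinearMap.inr ℝ ℝ E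
      = (deriv σ s / (σ s * φ y)) •
        (fderiv ℝ φ y w • LinearMap.id
          - ((G y w : E →L[ℝ] ℝ) : E →ₗ[ℝ] ℝ).smulRight (gradient G φ y)) := by
    ext u
    simp only [LinearMap.comp_apply, LinearMap.inr_apply, LinearMap.snd_apply,
      ContinuousLinearMap.coe_coe, curvatureEnd_apply, h.fderiv_christoffel_space_space hs hy,
      h.fderiv_christoffel_time_space hs hy,
      h.christoffel_lorentzWarped hs hy, LinearMap.smul_apply,
      LinearMap.sub_apply, LinearMap.smulRight_apply, LinearMap.id_apply, Prod.snd_sub,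
      Prod.snd_add, h.isMetricOn.symm y hy w u]
    simp
    match_scalars <;> field_simp
  rw [ricci, LinearMap.trace_real_prod, e]
  simp only [ContinuousLinearMap.coe_coe, curvatureEnd_apply, map_smul, map_sub,
    LinearMap.trace_smulRight, LinearMap.trace_id]
  simp [h.isMetricOn.symm y hy w, h.isMetricOn.apply_gradient hy]
  field_simp

theorem ricci_space_time (hs : s ∈ I) (hy : y ∈ U) (v : E) :
    ricci (lorentzWarped σ φ G) (s, y) (0, v) (1, 0)
      = (Module.finrank ℝ E - 1) * deriv σ s / (σ s * φ y) * fderiv ℝ φ y v := by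
  have hσ := h.ne_zero_fst s hs
  have hφ := h.ne_zero_snd y hy
  have e : LinearMap.snd ℝ ℝ E ∘ₗ (curvatureEnd (lorentzWarped σ φ G) (s, y) (0, v) (1, 0) :
        ℝ × E →ₗ[ℝ] ℝ × E) ∘ₗ LinearMap.inr ℝ ℝ E
      = (deriv σ s / (σ s * φ y)) •
        (fderiv ℝ φ y v • LinearMap.id
          - ((fderiv ℝ φ y : E →L[ℝ] ℝ) : E →ₗ[ℝ] ℝ).smulRight v) := by
    ext u
    simp only [LinearMap.comp_apply, LinearMap.inr_apply, LinearMap.snd_apply,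
      ContinuousLinearMap.coe_coe, curvatureEnd_apply,
      h.fderiv_christoffel_symm hs hy _ _ (1, 0), h.fderiv_christoffel_time_space hs hy,
      h.christoffel_lorentzWarped hs hy, LinearMap.smul_apply,
      LinearMap.sub_apply, LinearMap.smulRight_apply, LinearMap.id_apply, Prod.snd_sub,
      Prod.snd_add]
    simp [h.isMetricOn.christoffel_symm hy v u]
    match_scalars <;> field_simp
  rw [ricci, LinearMap.trace_real_prod, e]
  simp only [ContinuousLinearMap.coe_coe, curvatureEnd_apply, map_smul, map_sub,
    LinearMap.trace_smulRight, LinearMap.trace_id, Prod.fst_sub, Prod.fst_add,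
    h.fderiv_christoffel_time_time_fst hs hy, h.fderiv_christoffel_symm hs hy _ (0, v) (1, 0),
    h.fderiv_christoffel_time_space hs hy, h.christoffel_lorentzWarped hs hy]
  simp [h.isMetricOn.symm y hy v, h.isMetricOn.apply_gradient hy]
  field_simp
  ring

end IsWarpedOn

end CoordGeom

/-! ### Spatial components of the covariant derivative of the warped Ricci tensor. -/

namespace CoordGeom

variable {E : Type*} [NormedAddCommGroup E] [NormedSpace ℝ E]

section CovDeriv

variable {G : E → E →L[ℝ] E →L[ℝ] ℝ} {T T' : E → E → E → ℝ} {y u v : E}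

theorem covDeriv_sub (hT : DifferentiableAt ℝ (fun x => T x u v) y)
    (hT' : DifferentiableAt ℝ (fun x => T' x u v) y) (w : E) :
    covDeriv G (fun x u v => T x u v - T' x u v) y w u v
      = covDeriv G T y w u v - covDeriv G T' y w u v := by
  unfold covDeriv
  rw [fderiv_fun_sub hT hT', sub_apply]
  ring

theorem covDeriv_const_mul (hT : DifferentiableAt ℝ (fun x => T x u v) y) (c : ℝ) (w : E) :
    covDeriv G (fun x u v => c * T x u v) y w u v = c * covDeriv G T y w u v := by
  unfold covDeriv
  rw [fderiv_const_mul hT, smul_apply, smul_eq_mul]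
  ring

end CovDeriv

/-- The function `σ^◇` on the line with the metric `-dt²`. -/
noncomputable def lineDiamond (m : ℕ) (σ : ℝ → ℝ) (s : ℝ) : ℝ :=
  -(σ s * deriv (deriv σ) s) - ((m : ℝ) - 1) * deriv σ s ^ 2

variable [FiniteDimensional ℝ E]

namespace IsWarpedOn

variable {σ : ℝ → ℝ} {I : Set ℝ} {φ : E → ℝ} {G : E → E →L[ℝ] E →L[ℝ] ℝ} {U : Set E}
  (h : IsWarpedOn σ I φ G U) {s : ℝ} {y : E}

include h

theorem differentiableAt_metric_div (hy : y ∈ U) (u v : E) :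
    DifferentiableAt ℝ (fun x => G x u v / φ x ^ 2) y :=
  differentiableAt_div (h.differentiableAt_form hy u v) ((h.differentiableAt_snd hy).fun_pow 2)
    (pow_ne_zero 2 (h.ne_zero_snd y hy))

theorem fderiv_sq (hy : y ∈ U) (w : E) :
    fderiv ℝ (fun x => φ x ^ 2) y w = 2 * φ y * fderiv ℝ φ y w := by
  rw [fderiv_fun_pow 2 (h.differentiableAt_snd hy)]
  simp

theorem fderiv_metric_div (hy : y ∈ U) (u v w : E) :
    fderiv ℝ (fun x => G x u v / φ x ^ 2) y w
      = (G y (christoffel G y w u) v + G y u (christoffel G y w v)) / φ y ^ 2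
        - 2 * fderiv ℝ φ y w * G y u v / φ y ^ 3 := by
  have h0 := h.ne_zero_snd y hy
  rw [fderiv_div_apply (h.differentiableAt_form hy u v) ((h.differentiableAt_snd hy).fun_pow 2)
    (pow_ne_zero 2 h0), h.fderiv_sq hy, ← h.isMetricOn.fderiv_eq hy,
    fderiv_apply_apply (h.isMetricOn.differentiableAt hy)]
  field_simp

theorem covDeriv_metric_div (hy : y ∈ U) (u v w : E) :
    covDeriv G (fun x u v => G x u v / φ x ^ 2) y w u v
      = -(2 * fderiv ℝ φ y w * G y u v / φ y ^ 3) := by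
  rw [covDeriv, h.fderiv_metric_div hy]
  ring

theorem differentiableAt_differential_sq (hy : y ∈ U) (u v : E) :
    DifferentiableAt ℝ (fun x => fderiv ℝ φ x u * fderiv ℝ φ x v / φ x ^ 2) y :=
  differentiableAt_div
    (((h.differentiableAt_fderiv hy).clm_apply (differentiableAt_const u)).fun_mul
      ((h.differentiableAt_fderiv hy).clm_apply (differentiableAt_const v)))
    ((h.differentiableAt_snd hy).fun_pow 2) (pow_ne_zero 2 (h.ne_zero_snd y hy))

theorem covDeriv_differential_sq (hy : y ∈ U) (u v w : E) :
    covDeriv G (fun x u v => fderiv ℝ φ x u * fderiv ℝ φ x v / φ x ^ 2) y w u v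
      = (hessian G φ y w u * fderiv ℝ φ y v + fderiv ℝ φ y u * hessian G φ y w v) / φ y ^ 2
        - 2 * fderiv ℝ φ y w * fderiv ℝ φ y u * fderiv ℝ φ y v / φ y ^ 3 := by
  have h0 := h.ne_zero_snd y hy
  have hd := h.differentiableAt_fderiv hy
  have hu : DifferentiableAt ℝ (fun x => fderiv ℝ φ x u) y := hd.clm_apply (differentiableAt_const u)
  have hv : DifferentiableAt ℝ (fun x => fderiv ℝ φ x v) y := hd.clm_apply (differentiableAt_const v)
  have e : ∀ u, fderiv ℝ (fun x => fderiv ℝ φ x u) y w = fderiv ℝ (fderiv ℝ φ) y w u := fun u => by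
    rw [fderiv_clm_apply hd (differentiableAt_const _)]
    simp
  rw [covDeriv, fderiv_div_apply (hu.fun_mul hv) ((h.differentiableAt_snd hy).fun_pow 2)
    (pow_ne_zero 2 h0), h.fderiv_sq hy, fderiv_fun_mul hu hv, hessian_apply, hessian_apply]
  simp only [add_apply, smul_apply, smul_eq_mul, e]
  field_simp
  ring

theorem differentiableAt_warpHessian (hy : y ∈ U) (u v : E) :
    DifferentiableAt ℝ (fun x => warpHessian 1 G φ x u v) y := by
  have h1 : DifferentiableAt ℝ (fun x => hessian G φ x u v) y :=
    (((h.isMetricOn.contDiffAt_hessian hy (h.contDiffAt_snd hy)).clm_apply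
      contDiffAt_const).clm_apply contDiffAt_const).differentiableAt (by simp)
  exact (differentiableAt_div (differentiableAt_const _) (h.differentiableAt_snd hy)
    (h.ne_zero_snd y hy)).mul h1

theorem differentiableAt_ricci (hy : y ∈ U) (u v : E) :
    DifferentiableAt ℝ (fun x => ricci G x u v) y :=
  (h.isMetricOn.contDiffAt_ricci hy u v).differentiableAt (by simp)

theorem contDiffAt_lineDiamond (m : ℕ) (hs : s ∈ I) : ContDiffAt ℝ ∞ (lineDiamond m σ) s :=
  ((h.contDiffAt_fst hs).mul (h.contDiffAt_deriv_deriv hs)).neg.sub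
    (contDiffAt_const.mul ((h.contDiffAt_deriv hs).pow 2))

theorem ricci_space_space' (hs : s ∈ I) (hy : y ∈ U) (v w : E) :
    ricci (lorentzWarped σ φ G) (s, y) (0, v) (0, w)
      = ricci G y v w - warpHessian 1 G φ y v w
        - lineDiamond (Module.finrank ℝ E) σ s * (G y v w / φ y ^ 2) := by
  rw [h.ricci_space_space hs hy, warpHessian, lineDiamond]
  push_cast
  ring

theorem fderiv_ricci_space_space (hs : s ∈ I) (hy : y ∈ U) (r : ℝ) (w u v : E) :
    fderiv ℝ (fun z => ricci (lorentzWarped σ φ G) z (0, u) (0, v)) (s, y) (r, w)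
      = fderiv ℝ (fun x => ricci G x u v) y w - fderiv ℝ (fun x => warpHessian 1 G φ x u v) y w
        - (r * deriv (lineDiamond (Module.finrank ℝ E) σ) s * (G y u v / φ y ^ 2)
          + lineDiamond (Module.finrank ℝ E) σ s
            * ((G y (christoffel G y w u) v + G y u (christoffel G y w v)) / φ y ^ 2
              - 2 * fderiv ℝ φ y w * G y u v / φ y ^ 3)) := by
  have e : (fun z => ricci (lorentzWarped σ φ G) z (0, u) (0, v)) =ᶠ[nhds (s, y)]
      fun z : ℝ × E => (1 : ℝ) * (ricci G z.2 u v - warpHessian 1 G φ z.2 u v)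
        - lineDiamond (Module.finrank ℝ E) σ z.1 * (G z.2 u v / φ z.2 ^ 2) := by
    filter_upwards [h.mem_nhds hs hy] with z hz
    rw [h.ricci_space_space' hz.1 hz.2, one_mul]
  have hd : DifferentiableAt ℝ (lineDiamond (Module.finrank ℝ E) σ) s :=
    (h.contDiffAt_lineDiamond _ hs).differentiableAt (by simp)
  have h1 : DifferentiableAt ℝ (fun x => ricci G x u v - warpHessian 1 G φ x u v) y :=
    (h.differentiableAt_ricci hy u v).fun_sub (h.differentiableAt_warpHessian hy u v)
  have h2 := h.differentiableAt_metric_div hy u v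
  rw [e.fderiv_eq, fderiv_fun_sub
      (differentiableAt_mul_prod (α := fun _ => (1 : ℝ)) (differentiableAt_const _) h1)
      (differentiableAt_mul_prod hd h2), sub_apply,
    fderiv_mul_prod (α := fun _ => (1 : ℝ)) (differentiableAt_const _) h1,
    fderiv_mul_prod hd h2, h.fderiv_metric_div hy, deriv_const,
    fderiv_fun_sub (h.differentiableAt_ricci hy u v) (h.differentiableAt_warpHessian hy u v),
    sub_apply]
  ring

theorem ricci_prod_space (hs : s ∈ I) (hy : y ∈ U) (c : ℝ) (x v : E) :
    ricci (lorentzWarped σ φ G) (s, y) (c, x) (0, v)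
      = c * ((Module.finrank ℝ E - 1) * deriv σ s / (σ s * φ y) * fderiv ℝ φ y v)
        + (ricci G y x v - warpHessian 1 G φ y x v
          - lineDiamond (Module.finrank ℝ E) σ s * (G y x v / φ y ^ 2)) := by
  have e : (c, x) = c • ((1 : ℝ), (0 : E)) + (0, x) := by simp
  rw [e, ricci_add_left, ricci_smul_left, h.ricci_time_space hs hy, h.ricci_space_space' hs hy]

theorem ricci_space_prod (hs : s ∈ I) (hy : y ∈ U) (c : ℝ) (x v : E) :
    ricci (lorentzWarped σ φ G) (s, y) (0, v) (c, x)
      = c * ((Module.finrank ℝ E - 1) * deriv σ s / (σ s * φ y) * fderiv ℝ φ y v)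
        + (ricci G y v x - warpHessian 1 G φ y v x
          - lineDiamond (Module.finrank ℝ E) σ s * (G y v x / φ y ^ 2)) := by
  have e : (c, x) = c • ((1 : ℝ), (0 : E)) + (0, x) := by simp
  rw [e, ricci_add_right, ricci_smul_right, h.ricci_space_time hs hy, h.ricci_space_space' hs hy]

/-- The spatial components of the covariant derivative of the Ricci tensor of a doubly warped
space-time. -/
theorem covDeriv_ricci_space (hs : s ∈ I) (hy : y ∈ U) (w u v : E) :
    covDeriv (lorentzWarped σ φ G) (ricci (lorentzWarped σ φ G)) (s, y) (0, w) (0, u) (0, v)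
      = covDeriv G (ricci G) y w u v - covDeriv G (warpHessian 1 G φ) y w u v
        + 2 * (lineDiamond (Module.finrank ℝ E) σ s / φ y ^ 3) * fderiv ℝ φ y w * G y u v
        - (Module.finrank ℝ E - 1) * deriv σ s ^ 2 / φ y ^ 3
          * (G y w v * fderiv ℝ φ y u + G y w u * fderiv ℝ φ y v) := by
  have hσ := h.ne_zero_fst s hs
  have hφ := h.ne_zero_snd y hy
  rw [covDeriv, covDeriv, covDeriv, h.fderiv_ricci_space_space hs hy,
    h.christoffel_lorentzWarped hs hy, h.christoffel_lorentzWarped hs hy]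
  simp only [zero_mul, zero_smul, add_zero, zero_add, smul_zero, zero_div]
  -- `Γ(w, u)` has time component `σ σ̇ G(w, u) / φ²`. Paired with the mixed Ricci component it
  -- produces the `(n - 1) σ̇²` term, negative because the covariant derivative subtracts
  -- Christoffel corrections. The component `Ric(∂_t, ∂_t)` does not occur.
  rw [h.ricci_prod_space hs hy, h.ricci_space_prod hs hy]
  field_simp
  ring

/-- The components of the covariant derivative of the spatial part of the Ricci tensor of a doubly
warped space-time in the direction of time. -/
theorem covDeriv_ricci_time (hs : s ∈ I) (hy : y ∈ U) (u v : E) :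
    covDeriv (lorentzWarped σ φ G) (ricci (lorentzWarped σ φ G)) (s, y) (1, 0) (0, u) (0, v)
      = -(deriv (lineDiamond (Module.finrank ℝ E) σ) s * (G y u v / φ y ^ 2))
        - 2 * (deriv σ s / σ s) * ((Module.finrank ℝ E - 1)
            * (fderiv ℝ φ y u * fderiv ℝ φ y v / φ y ^ 2)
          + (ricci G y u v - warpHessian 1 G φ y u v
            - lineDiamond (Module.finrank ℝ E) σ s * (G y u v / φ y ^ 2))) := by
  have hσ := h.ne_zero_fst s hs
  have hφ := h.ne_zero_snd y hy
  rw [covDeriv, h.fderiv_ricci_space_space hs hy,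
    h.christoffel_lorentzWarped hs hy, h.christoffel_lorentzWarped hs hy]
  simp only [zero_mul, zero_smul, mul_zero, add_zero, zero_add, smul_zero, zero_div, map_zero,
    zero_apply, one_mul, one_smul, sub_zero]
  -- Here `Γ(∂_t, u)` is `(dφ(u) / φ, (σ̇ / σ) u)`: the two corrections give the common factor `2 σ̇
  -- / σ`, and the time components paired with the mixed Ricci components give `df ⊗ df`.
  rw [h.ricci_prod_space hs hy, h.ricci_space_prod hs hy, ricci_smul_left, ricci_smul_right]
  simp only [warpHessian, map_smul, smul_apply, smul_eq_mul]
  field_simp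
  ring

end IsWarpedOn

end CoordGeom

/-! ### Rigidity of parallel Ricci tensor when σ̇ ≠ 0 and df ≠ 0. -/

namespace CoordGeom

variable {E : Type*} [NormedAddCommGroup E] [NormedSpace ℝ E] [FiniteDimensional ℝ E]

theorem exists_ne_zero_apply_eq_zero (hn : 2 ≤ Module.finrank ℝ E) (L : E →L[ℝ] ℝ) :
    ∃ u, u ≠ 0 ∧ L u = 0 := by
  by_contra! hc
  have hinj : Function.Injective (L : E →ₗ[ℝ] ℝ) := by
    rw [injective_iff_map_eq_zero]
    intro u hu
    by_contra hu0
    exact hc u hu0 hu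
  have := LinearMap.finrank_le_finrank_of_injective hinj
  rw [Module.finrank_self] at this
  omega

namespace IsWarpedOn

variable {σ : ℝ → ℝ} {I : Set ℝ} {φ : E → ℝ} {G : E → E →L[ℝ] E →L[ℝ] ℝ} {U : Set E}
  (h : IsWarpedOn σ I φ G U) {s : ℝ} {y : E}

section Parallel

variable (hpos : ∀ y ∈ U, ∀ u, u ≠ 0 → 0 < G y u u)
  (hP : ∀ s ∈ I, ∀ y ∈ U, ∀ w u v,
    covDeriv (lorentzWarped σ φ G) (ricci (lorentzWarped σ φ G)) (s, y) w u v = 0)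

include h hpos hP

/-- Evaluate the spatial identity on `(w, u, u)` with `u` in the kernel of `dφ`: the `σ̇²` term
drops out, and `σ^◇` is the only quantity left that depends on time. -/
theorem lineDiamond_eq (hn : 2 ≤ Module.finrank ℝ E) (hs : s ∈ I) (hy : y ∈ U)
    (hφ : fderiv ℝ φ y ≠ 0) {s' : ℝ} (hs' : s' ∈ I) :
    lineDiamond (Module.finrank ℝ E) σ s' = lineDiamond (Module.finrank ℝ E) σ s := by
  obtain ⟨w, hw⟩ : ∃ w, fderiv ℝ φ y w ≠ 0 := by
    by_contra! hc
    exact hφ (ContinuousLinearMap.ext hc)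
  obtain ⟨u, hu0, hu⟩ := exists_ne_zero_apply_eq_zero hn (fderiv ℝ φ y)
  have h1 := h.covDeriv_ricci_space hs hy w u u
  have h2 := h.covDeriv_ricci_space hs' hy w u u
  rw [hP s hs y hy, hu] at h1
  rw [hP s' hs' y hy, hu] at h2
  have hG := (hpos y hy u hu0).ne'
  have h0 := h.ne_zero_snd y hy
  have h3 : 2 * (lineDiamond (Module.finrank ℝ E) σ s' / φ y ^ 3) * fderiv ℝ φ y w * G y u u
      = 2 * (lineDiamond (Module.finrank ℝ E) σ s / φ y ^ 3) * fderiv ℝ φ y w * G y u u := by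
    linarith
  field_simp at h3
  exact h3

/-- With `σ^◇` known to be constant, evaluation on `(w, w, w)` with `dφ(w) ≠ 0` isolates `σ̇²`. -/
theorem deriv_sq_eq (hn : 2 ≤ Module.finrank ℝ E) (hs : s ∈ I) (hy : y ∈ U)
    (hφ : fderiv ℝ φ y ≠ 0) {s' : ℝ} (hs' : s' ∈ I) :
    deriv σ s' ^ 2 = deriv σ s ^ 2 := by
  obtain ⟨w, hw⟩ : ∃ w, fderiv ℝ φ y w ≠ 0 := by
    by_contra! hc
    exact hφ (ContinuousLinearMap.ext hc)
  have h1 := h.covDeriv_ricci_space hs hy w w w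
  have h2 := h.covDeriv_ricci_space hs' hy w w w
  rw [hP s hs y hy] at h1
  rw [hP s' hs' y hy, h.lineDiamond_eq hpos hP hn hs hy hφ hs'] at h2
  have hw0 : w ≠ 0 := fun e => hw (by rw [e, map_zero])
  have hG := (hpos y hy w hw0).ne'
  have h0 := h.ne_zero_snd y hy
  have hn' : ((Module.finrank ℝ E : ℝ) - 1) ≠ 0 := by
    have : (2 : ℝ) ≤ Module.finrank ℝ E := by exact_mod_cast hn
    linarith
  have h3 : ((Module.finrank ℝ E : ℝ) - 1) * deriv σ s' ^ 2 / φ y ^ 3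
        * (G y w w * fderiv ℝ φ y w + G y w w * fderiv ℝ φ y w)
      = (Module.finrank ℝ E - 1) * deriv σ s ^ 2 / φ y ^ 3
        * (G y w w * fderiv ℝ φ y w + G y w w * fderiv ℝ φ y w) := by
    linarith
  have h4 : G y w w * fderiv ℝ φ y w + G y w w * fderiv ℝ φ y w ≠ 0 := by
    rw [← two_mul]
    exact mul_ne_zero two_ne_zero (mul_ne_zero hG hw)
  have h5 := mul_right_cancel₀ h4 h3
  field_simp at h5
  exact h5

theorem deriv_lineDiamond_eq_zero (hn : 2 ≤ Module.finrank ℝ E) (hs : s ∈ I) (hy : y ∈ U)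
    (hφ : fderiv ℝ φ y ≠ 0) : deriv (lineDiamond (Module.finrank ℝ E) σ) s = 0 := by
  have e : lineDiamond (Module.finrank ℝ E) σ =ᶠ[nhds s]
      fun _ => lineDiamond (Module.finrank ℝ E) σ s := by
    filter_upwards [h.isOpen_fst.mem_nhds hs] with t ht
      using h.lineDiamond_eq hpos hP hn hs hy hφ ht
  rw [e.deriv_eq, deriv_const]

theorem deriv_deriv_eq_zero (hn : 2 ≤ Module.finrank ℝ E) (hs : s ∈ I) (hy : y ∈ U)
    (hφ : fderiv ℝ φ y ≠ 0) (hσ : deriv σ s ≠ 0) : deriv (deriv σ) s = 0 := by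
  have e : (fun t => deriv σ t ^ 2) =ᶠ[nhds s] fun _ => deriv σ s ^ 2 := by
    filter_upwards [h.isOpen_fst.mem_nhds hs] with t ht
      using h.deriv_sq_eq hpos hP hn hs hy hφ ht
  have h1 := e.deriv_eq
  rw [deriv_fun_pow (h.differentiableAt_deriv hs), deriv_const] at h1
  simpa [hσ] using h1

/-- The point `y` serves only to make `σ^◇` constant in time; the vanishing time component can then
be divided by `2 σ̇ / σ` at every point `x` of the chart, critical points of `φ` included. -/
theorem ricci_eq (hn : 2 ≤ Module.finrank ℝ E) (hs : s ∈ I) (hy : y ∈ U)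
    (hφ : fderiv ℝ φ y ≠ 0) (hσ : deriv σ s ≠ 0) {x : E} (hx : x ∈ U) (u v : E) :
    ricci G x u v = warpHessian 1 G φ x u v
      - (-lineDiamond (Module.finrank ℝ E) σ s) * (G x u v / φ x ^ 2)
      - (Module.finrank ℝ E - 1) * (fderiv ℝ φ x u * fderiv ℝ φ x v / φ x ^ 2) := by
  have h1 := h.covDeriv_ricci_time hs hx u v
  rw [hP s hs x hx, h.deriv_lineDiamond_eq_zero hpos hP hn hs hy hφ, zero_mul, neg_zero,
    zero_sub, eq_comm, neg_eq_zero, mul_eq_zero] at h1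
  have h2 := h1.resolve_left (mul_ne_zero two_ne_zero (div_ne_zero hσ (h.ne_zero_fst s hs)))
  linarith

/-- Differentiate the formula for `Ric` and insert it into the spatial identity: the `𝓕` terms and
the `σ^◇` terms cancel, and the remainder is divisible by n - 1. -/
theorem covDeriv_differential_sq_eq (hn : 2 ≤ Module.finrank ℝ E) (hs : s ∈ I) (hy : y ∈ U)
    (hφ : fderiv ℝ φ y ≠ 0) (hσ : deriv σ s ≠ 0) {x : E} (hx : x ∈ U) (w u v : E) :
    covDeriv G (fun x u v => fderiv ℝ φ x u * fderiv ℝ φ x v / φ x ^ 2) x w u v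
      = -(deriv σ s ^ 2 / φ x ^ 3 * (G x w v * fderiv ℝ φ x u + G x w u * fderiv ℝ φ x v)) := by
  have e : ricci G =ᶠ[nhds x] fun x u v => warpHessian 1 G φ x u v
      - (-lineDiamond (Module.finrank ℝ E) σ s) * (G x u v / φ x ^ 2)
      - (Module.finrank ℝ E - 1) * (fderiv ℝ φ x u * fderiv ℝ φ x v / φ x ^ 2) := by
    filter_upwards [h.isMetricOn.mem_nhds hx] with z hz
    funext u v
    exact h.ricci_eq hpos hP hn hs hy hφ hσ hz u v
  have h1 := h.covDeriv_ricci_space hs hx w u v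
  have dF := h.differentiableAt_warpHessian hx u v
  have dG := h.differentiableAt_metric_div hx u v
  have dB := h.differentiableAt_differential_sq hx u v
  rw [hP s hs x hx, covDeriv_congr (Filter.EventuallyEq.refl _ _) e,
    covDeriv_sub (dF.fun_sub (dG.const_mul _)) (dB.const_mul _), covDeriv_sub dF (dG.const_mul _),
    covDeriv_const_mul dG, covDeriv_const_mul dB, h.covDeriv_metric_div hx] at h1
  have hn' : ((Module.finrank ℝ E : ℝ) - 1) ≠ 0 := by
    have : (2 : ℝ) ≤ Module.finrank ℝ E := by exact_mod_cast hn
    linarith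
  apply mul_left_cancel₀ hn'
  have h2 : lineDiamond (Module.finrank ℝ E) σ s * (2 * fderiv ℝ φ x w * G x u v / φ x ^ 3)
    = 2 * (lineDiamond (Module.finrank ℝ E) σ s / φ x ^ 3) * fderiv ℝ φ x w * G x u v := by ring
  linear_combination h1 - h2

/-- Put `A = φ H - dφ ⊗ dφ + σ̇² G`. The previous lemma, expanded, says `A(w,u) dφ(v) + A(w,v) dφ(u)
= 0`. Taking `u = v = e` with `dφ(e) ≠ 0` gives `A(w,e) = 0`; then `v = e` alone gives `A = 0`. -/
theorem hessian_eq (hn : 2 ≤ Module.finrank ℝ E) (hs : s ∈ I) (hσ : deriv σ s ≠ 0)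
    {x : E} (hx : x ∈ U) (hφ : fderiv ℝ φ x ≠ 0) (u v : E) :
    φ x * hessian G φ x u v
      = fderiv ℝ φ x u * fderiv ℝ φ x v - deriv σ s ^ 2 * G x u v := by
  have h0 := h.ne_zero_snd x hx
  obtain ⟨e, he⟩ : ∃ w, fderiv ℝ φ x w ≠ 0 := by
    by_contra! hc
    exact hφ (ContinuousLinearMap.ext hc)
  have key : ∀ w u v,
      (φ x * hessian G φ x w u - fderiv ℝ φ x w * fderiv ℝ φ x u + deriv σ s ^ 2 * G x w u)
          * fderiv ℝ φ x v
        + (φ x * hessian G φ x w v - fderiv ℝ φ x w * fderiv ℝ φ x v + deriv σ s ^ 2 * G x w v)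
          * fderiv ℝ φ x u = 0 := by
    intro w u v
    have h1 := h.covDeriv_differential_sq_eq hpos hP hn hs hx hφ hσ hx w u v
    rw [h.covDeriv_differential_sq hx] at h1
    field_simp at h1
    linear_combination h1
  have h1 : φ x * hessian G φ x u e - fderiv ℝ φ x u * fderiv ℝ φ x e
      + deriv σ s ^ 2 * G x u e = 0 := by
    have := key u e e
    rw [← two_mul] at this
    simpa [he] using this
  have h2 := key u v e
  rw [h1, zero_mul, add_zero, mul_eq_zero] at h2
  linarith [h2.resolve_right he]

theorem covDeriv_warpHessian_eq (hn : 2 ≤ Module.finrank ℝ E) (hs : s ∈ I) (hy : y ∈ U)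
    (hφ : fderiv ℝ φ y ≠ 0) (hσ : deriv σ s ≠ 0) (w u v : E) :
    covDeriv G (warpHessian 1 G φ) y w u v
      = 2 * (deriv σ s ^ 2 / φ y ^ 3) * fderiv ℝ φ y w * G y u v
        - deriv σ s ^ 2 / φ y ^ 3 * (G y w v * fderiv ℝ φ y u + G y w u * fderiv ℝ φ y v) := by
  have e : warpHessian 1 G φ =ᶠ[nhds y] fun x u v =>
      fderiv ℝ φ x u * fderiv ℝ φ x v / φ x ^ 2 - deriv σ s ^ 2 * (G x u v / φ x ^ 2) := by
    filter_upwards [h.isMetricOn.mem_nhds hy,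
      -- The Hessian formula needs `dφ ≠ 0`, an open condition, so it may be differentiated at `y`.
      (h.differentiableAt_fderiv hy).continuousAt.eventually_ne hφ] with x hx hx'
    funext u v
    have h1 := h.hessian_eq hpos hP hn hs hσ hx hx' u v
    have h0 := h.ne_zero_snd x hx
    rw [warpHessian]
    field_simp
    linear_combination h1
  rw [covDeriv_congr (Filter.EventuallyEq.refl _ _) e,
    covDeriv_sub (h.differentiableAt_differential_sq hy u v)
      ((h.differentiableAt_metric_div hy u v).const_mul _),
    covDeriv_const_mul (h.differentiableAt_metric_div hy u v), h.covDeriv_metric_div hy,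
    h.covDeriv_differential_sq_eq hpos hP hn hs hy hφ hσ hy]
  ring

/-- If the warping functions are not constant, then the equation for `𝓕` fails on a pair of
vectors for which the two sign conventions of its last term agree. -/
theorem exists_covDeriv_warpHessian_ne (hn : 2 ≤ Module.finrank ℝ E) (hs : s ∈ I) (hy : y ∈ U)
    (hφ : fderiv ℝ φ y ≠ 0) (hσ : deriv σ s ≠ 0) :
    ∃ w u, fderiv ℝ φ y u = 0 ∧ covDeriv G (warpHessian 1 G φ) y w u u
      ≠ 2 * (lineDiamond (Module.finrank ℝ E) σ s / φ y ^ 3) * fderiv ℝ φ y w * G y u u := by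
  obtain ⟨w, hw⟩ : ∃ w, fderiv ℝ φ y w ≠ 0 := by
    by_contra! hc
    exact hφ (ContinuousLinearMap.ext hc)
  obtain ⟨u, hu0, hu⟩ := exists_ne_zero_apply_eq_zero hn (fderiv ℝ φ y)
  refine ⟨w, u, hu, fun hc => ?_⟩
  rw [h.covDeriv_warpHessian_eq hpos hP hn hs hy hφ hσ, hu, lineDiamond,
    h.deriv_deriv_eq_zero hpos hP hn hs hy hφ hσ] at hc
  have hG := (hpos y hy u hu0).ne'
  have h0 := h.ne_zero_snd y hy
  have hn' : (Module.finrank ℝ E : ℝ) ≠ 0 := by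
    have : (2 : ℝ) ≤ Module.finrank ℝ E := by exact_mod_cast hn
    linarith
  -- Since `σ̈ = 0`, the coefficients to be compared are `σ̇²` and `-(n - 1) σ̇²`; their difference
  -- is `n σ̇²`.
  have : (Module.finrank ℝ E : ℝ) * deriv σ s ^ 2 * fderiv ℝ φ y w * G y u u = 0 := by
    field_simp at hc
    linear_combination hc / 2
  have hσ2 := pow_ne_zero 2 hσ
  exact mul_ne_zero (mul_ne_zero (mul_ne_zero hn' hσ2) hw) hG this

end Parallel

end IsWarpedOn

end CoordGeom

/-! ### Chart expressions of the Riemannian metric and of functions on M. -/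

section RiemannianCharts

variable {E : Type*} [NormedAddCommGroup E] [NormedSpace ℝ E] [FiniteDimensional ℝ E]
    {M : Type*} [TopologicalSpace M] [ChartedSpace E M] [IsManifold 𝓘(ℝ, E) ∞ M]

theorem coordExpr_apply {F H X : Type*} [NormedAddCommGroup F] [NormedSpace ℝ F]
    [TopologicalSpace H] (J : ModelWithCorners ℝ F H) [TopologicalSpace X] [ChartedSpace H X]
    (g : BilinField J X) (p : X) (y u v : F) :
    coordExpr J g p y u v = g ((extChartAt J p).symm y)
      (mfderiv 𝓘(ℝ, F) J (extChartAt J p).symm y u)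
      (mfderiv 𝓘(ℝ, F) J (extChartAt J p).symm y v) := rfl

theorem contDiffOn_coordExpr (g : Bundle.ContMDiffRiemannianMetric 𝓘(ℝ, E) ∞ E
      (fun x : M => TangentSpace 𝓘(ℝ, E) x)) (p : M) :
    ContDiffOn ℝ ∞ (coordExpr 𝓘(ℝ, E) g.inner p) (extChartAt 𝓘(ℝ, E) p).target := by
  refine contDiffOn_clm_apply.2 fun u => contDiffOn_clm_apply.2 fun v => ?_
  have hopen : IsOpen (extChartAt 𝓘(ℝ, E) p).target := isOpen_extChartAt_target p
  have hs := contMDiffOn_extChartAt_symm (n := ∞) (I := 𝓘(ℝ, E)) p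
  -- The coordinate fields are the tangent map of the inverse chart applied to constant fields, so
  -- they are smooth along the inverse chart.
  have hvec : ∀ u : E, ContMDiffOn 𝓘(ℝ, E) (𝓘(ℝ, E).prod 𝓘(ℝ, E)) ∞
      (fun y => (⟨(extChartAt 𝓘(ℝ, E) p).symm y,
        mfderiv 𝓘(ℝ, E) 𝓘(ℝ, E) (extChartAt 𝓘(ℝ, E) p).symm y u⟩ : TangentBundle 𝓘(ℝ, E) M))
      (extChartAt 𝓘(ℝ, E) p).target := by
    intro u
    have ht := hs.contMDiffOn_tangentMapWithin (m := ∞) (by simp) hopen.uniqueMDiffOn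
    have hc : ContMDiffOn 𝓘(ℝ, E) (𝓘(ℝ, E).prod 𝓘(ℝ, E)) ∞
        (fun y => (⟨y, u⟩ : TangentBundle 𝓘(ℝ, E) E)) (extChartAt 𝓘(ℝ, E) p).target := by
      exact contMDiffOn_vectorSpace_iff_contDiffOn.2 contDiffOn_const
    refine (ht.comp hc fun y hy => hy).congr fun y hy => ?_
    simp only [Function.comp, tangentMapWithin]
    rw [mfderivWithin_of_isOpen hopen hy]
  rw [← contMDiffOn_iff_contDiffOn]
  intro y hy
  have hg : ContMDiffWithinAt 𝓘(ℝ, E) (𝓘(ℝ, E).prod 𝓘(ℝ, E →L[ℝ] E →L[ℝ] ℝ)) ∞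
      (fun y => Bundle.TotalSpace.mk' (E →L[ℝ] E →L[ℝ] ℝ)
        (E := fun x : M => (TangentSpace 𝓘(ℝ, E) x →L[ℝ] TangentSpace 𝓘(ℝ, E) x →L[ℝ] ℝ))
        ((extChartAt 𝓘(ℝ, E) p).symm y) (g.inner ((extChartAt 𝓘(ℝ, E) p).symm y)))
      (extChartAt 𝓘(ℝ, E) p).target y :=
    g.contMDiff.contMDiffAt.comp_contMDiffWithinAt y (hs y hy)
  have := ContMDiffWithinAt.clm_bundle_apply₂ (F₃ := ℝ) (E₃ := fun _ : M => ℝ) hg (hvec u y hy) (hvec v y hy)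
  rw [Bundle.contMDiffWithinAt_totalSpace] at this
  exact this.2

theorem coordExpr_pos (g : Bundle.ContMDiffRiemannianMetric 𝓘(ℝ, E) ∞ E
      (fun x : M => TangentSpace 𝓘(ℝ, E) x)) (p : M) {y : E}
    (hy : y ∈ (extChartAt 𝓘(ℝ, E) p).target) {u : E} (hu : u ≠ 0) :
    0 < coordExpr 𝓘(ℝ, E) g.inner p y u u := by
  rw [coordExpr_apply]
  refine g.pos _ _ fun h0 => hu ?_
  have : IsManifold 𝓘(ℝ, E) 1 M := IsManifold.of_le (n := ∞) (by simp)
  have hinv := isInvertible_mfderivWithin_extChartAt_symm (I := 𝓘(ℝ, E)) hy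
  rw [ModelWithCorners.range_eq_univ, mfderivWithin_univ] at hinv
  exact hinv.injective (h0.trans (map_zero _).symm)

theorem isMetricOn_coordExpr (g : Bundle.ContMDiffRiemannianMetric 𝓘(ℝ, E) ∞ E
      (fun x : M => TangentSpace 𝓘(ℝ, E) x)) (p : M) :
    CoordGeom.IsMetricOn (coordExpr 𝓘(ℝ, E) g.inner p) (extChartAt 𝓘(ℝ, E) p).target where
  isOpen := isOpen_extChartAt_target p
  contDiffOn := contDiffOn_coordExpr g p
  symm := fun y _ u v => g.symm _ _ _
  nondegenerate := fun y hy u hu => by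
    by_contra h0
    exact (coordExpr_pos g p hy h0).ne' (hu u)

theorem contDiffOn_coordFun {f : M → ℝ} (hf : ContMDiff 𝓘(ℝ, E) 𝓘(ℝ, ℝ) ∞ f) (p : M) :
    ContDiffOn ℝ ∞ (coordFun 𝓘(ℝ, E) f p) (extChartAt 𝓘(ℝ, E) p).target := by
  rw [← contMDiffOn_iff_contDiffOn]
  exact hf.comp_contMDiffOn (contMDiffOn_extChartAt_symm p)

end RiemannianCharts

/-! ### The interval with the metric -dt². -/

section Line

variable (I : TopologicalSpace.Opens ℝ)

theorem coe_extChartAt_opens (t x : I) : extChartAt 𝓘(ℝ, ℝ) t x = (x : ℝ) := rfl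

theorem extChartAt_opens_target (t : I) : (extChartAt 𝓘(ℝ, ℝ) t).target = (I : Set ℝ) := by
  rw [← (extChartAt 𝓘(ℝ, ℝ) t).image_source_eq_target]
  ext s
  simp [TopologicalSpace.Opens.chartAt_eq, chartAt_self_eq]

theorem coe_extChartAt_opens_symm (t : I) {s : ℝ} (hs : s ∈ I) :
    (((extChartAt 𝓘(ℝ, ℝ) t).symm s : I) : ℝ) = s :=
  (extChartAt 𝓘(ℝ, ℝ) t).right_inv (by rwa [extChartAt_opens_target])

theorem mdifferentiableAt_extChartAt_opens_symm (t : I) {s : ℝ} (hs : s ∈ I) :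
    MDifferentiableAt 𝓘(ℝ, ℝ) 𝓘(ℝ, ℝ) (extChartAt 𝓘(ℝ, ℝ) t).symm s :=
  mdifferentiableOn_extChartAt_symm.mdifferentiableAt
    (by rw [extChartAt_opens_target]; exact I.isOpen.mem_nhds hs)

theorem coordExpr_minusDtSq (t : I) {s : ℝ} (hs : s ∈ I) (r q : ℝ) :
    coordExpr 𝓘(ℝ, ℝ) (minusDtSq I) t s r q = -(r * q) := by
  have hval : MDifferentiableAt 𝓘(ℝ, ℝ) 𝓘(ℝ, ℝ) (Subtype.val : I → ℝ)
      ((extChartAt 𝓘(ℝ, ℝ) t).symm s) :=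
    (contMDiff_subtype_val (n := 1)).mdifferentiable (by simp) _
  have e : (Subtype.val : I → ℝ) ∘ (extChartAt 𝓘(ℝ, ℝ) t).symm =ᶠ[nhds s] id := by
    filter_upwards [I.isOpen.mem_nhds hs] with x hx using coe_extChartAt_opens_symm I t hx
  have key : ∀ r, mfderiv 𝓘(ℝ, ℝ) 𝓘(ℝ, ℝ) (Subtype.val : I → ℝ) ((extChartAt 𝓘(ℝ, ℝ) t).symm s)
      (mfderiv 𝓘(ℝ, ℝ) 𝓘(ℝ, ℝ) (extChartAt 𝓘(ℝ, ℝ) t).symm s r) = r := fun r => by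
    have h1 := mfderiv_comp s hval (mdifferentiableAt_extChartAt_opens_symm I t hs)
    rw [e.mfderiv_eq, mfderiv_id] at h1
    exact (congrArg (fun L => L r) h1).symm
  rw [coordExpr_apply]
  change -(ContinuousLinearMap.mul ℝ ℝ _ _) = _
  exact congrArg Neg.neg (congrArg₂ (fun a b : ℝ => a * b) (key r) (key q))

theorem isMetricOn_neg_mul :
    CoordGeom.IsMetricOn (fun _ : ℝ => -ContinuousLinearMap.mul ℝ ℝ) Set.univ where
  isOpen := isOpen_univ
  contDiffOn := contDiffOn_const
  symm := fun _ _ u v => by simp [mul_comm]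
  nondegenerate := fun _ _ u hu => by simpa using hu 1

theorem sharp_neg_mul (s : ℝ) (L : ℝ →L[ℝ] ℝ) :
    CoordGeom.sharp (fun _ : ℝ => -ContinuousLinearMap.mul ℝ ℝ) s L = -L 1 := by
  have e : L = (-ContinuousLinearMap.mul ℝ ℝ) (-L 1) := by
    ext
    simp
  conv_lhs => rw [e]
  exact isMetricOn_neg_mul.sharp_apply (Set.mem_univ s) _

theorem christoffel_neg_mul (s : ℝ) :
    CoordGeom.christoffel (fun _ : ℝ => -ContinuousLinearMap.mul ℝ ℝ) s = 0 := by
  ext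
  simp [CoordGeom.christoffel_apply, sharp_neg_mul, CoordGeom.koszul_apply]

/-- Each chart of `I` is the inclusion, so the metric has constant coefficient -1: Christoffel
symbols vanish and raising an index changes the sign. -/
theorem warpDiamond_minusDtSq (m : ℕ) {σ : ℝ → ℝ} (hσ : ContDiffOn ℝ ∞ σ I) (t : I) :
    warpDiamond 𝓘(ℝ, ℝ) m (minusDtSq I) (fun s : I => σ s) t = CoordGeom.lineDiamond m σ t := by
  have hI := I.isOpen.mem_nhds t.2
  have e1 : coordExpr 𝓘(ℝ, ℝ) (minusDtSq I) t =ᶠ[nhds (t : ℝ)]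
      fun _ => -ContinuousLinearMap.mul ℝ ℝ := by
    filter_upwards [hI] with s hs
    exact ContinuousLinearMap.ext fun r => ContinuousLinearMap.ext fun q =>
      coordExpr_minusDtSq I t hs r q
  have e2 : coordFun 𝓘(ℝ, ℝ) (fun s : I => σ s) t =ᶠ[nhds (t : ℝ)] σ := by
    filter_upwards [hI] with s hs
    exact congrArg σ (coe_extChartAt_opens_symm I t hs)
  have hd : DifferentiableAt ℝ (fderiv ℝ σ) t :=
    ((hσ.contDiffAt hI).fderiv_right (m := ∞) (by simp)).differentiableAt (by simp)
  have h2 : fderiv ℝ (fderiv ℝ σ) (t : ℝ) 1 1 = deriv (deriv σ) t := by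
    have : deriv σ = fun x => fderiv ℝ σ x 1 := rfl
    rw [this, ← fderiv_apply_one_eq_deriv, fderiv_clm_apply hd (differentiableAt_const _)]
    simp
  have htr : ∀ T : ℝ →L[ℝ] ℝ, LinearMap.trace ℝ ℝ (T : ℝ →ₗ[ℝ] ℝ) = T 1 := fun T => by
    have : (T : ℝ →ₗ[ℝ] ℝ) = (T : ℝ →ₗ[ℝ] ℝ).smulRight 1 := by ext; simp
    rw [this, LinearMap.trace_smulRight]
    rfl
  rw [warpDiamond, coe_extChartAt_opens, CoordGeom.diamond_congr m e1 e2, CoordGeom.diamond,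
    CoordGeom.laplacian, htr, CoordGeom.gradient, sharp_neg_mul, CoordGeom.lineDiamond]
  rw [fderiv_apply_one_eq_deriv] at h2
  simp [sharp_neg_mul, CoordGeom.hessian_apply, christoffel_neg_mul, h2]
  ring

end Line

/-! ### Charts of the space-time, and the theorem. -/

section Spacetime

theorem doublyWarped_apply {F₁ F₂ : Type*} [NormedAddCommGroup F₁] [NormedSpace ℝ F₁]
    [NormedAddCommGroup F₂] [NormedSpace ℝ F₂] {H₁ H₂ : Type*} [TopologicalSpace H₁]
    [TopologicalSpace H₂] (J₁ : ModelWithCorners ℝ F₁ H₁) (J₂ : ModelWithCorners ℝ F₂ H₂)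
    {X₁ X₂ : Type*} [TopologicalSpace X₁] [ChartedSpace H₁ X₁] [TopologicalSpace X₂]
    [ChartedSpace H₂ X₂] (g₁ : BilinField J₁ X₁) (g₂ : BilinField J₂ X₂)
    (f₁ : X₁ → ℝ) (f₂ : X₂ → ℝ) (x : X₁ × X₂) (u v : F₁ × F₂) :
    doublyWarped J₁ J₂ g₁ g₂ f₁ f₂ x u v
      = f₂ x.2 ^ 2 * g₁ x.1 u.1 v.1 + f₁ x.1 ^ 2 * g₂ x.2 u.2 v.2 := by
  rw [doublyWarped, mfderiv_fst, mfderiv_snd]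
  rfl

variable {E : Type*} [NormedAddCommGroup E] [NormedSpace ℝ E]
    {M : Type*} [TopologicalSpace M] [ChartedSpace E M] [IsManifold 𝓘(ℝ, E) 1 M]

theorem extChartAt_spacetime_target (I : TopologicalSpace.Opens ℝ) (t : I) (p : M) :
    (extChartAt (𝓘(ℝ, ℝ).prod 𝓘(ℝ, E)) (t, p)).target
      = (I : Set ℝ) ×ˢ (extChartAt 𝓘(ℝ, E) p).target := by
  rw [extChartAt_prod, PartialEquiv.prod_target, extChartAt_opens_target]

theorem coordExpr_doublyWarpedSpacetime (I : TopologicalSpace.Opens ℝ) (σ : ℝ → ℝ)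
    (g : BilinField 𝓘(ℝ, E) M) (f : M → ℝ) (t : I) (p : M) {z : ℝ × E}
    (hz : z ∈ (I : Set ℝ) ×ˢ (extChartAt 𝓘(ℝ, E) p).target) :
    coordExpr (𝓘(ℝ, ℝ).prod 𝓘(ℝ, E)) (doublyWarpedSpacetime I σ g f) (t, p) z
      = CoordGeom.lorentzWarped σ (coordFun 𝓘(ℝ, E) f p) (coordExpr 𝓘(ℝ, E) g p) z := by
  obtain ⟨s, y⟩ := z
  have hΦ : ((extChartAt (𝓘(ℝ, ℝ).prod 𝓘(ℝ, E)) (t, p)).symm : ℝ × E → I × M)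
      = Prod.map (extChartAt 𝓘(ℝ, ℝ) t).symm (extChartAt 𝓘(ℝ, E) p).symm := by
    rw [extChartAt_prod]
    rfl
  have h1 := mdifferentiableAt_extChartAt_opens_symm I t hz.1
  have h2 : MDifferentiableAt 𝓘(ℝ, E) 𝓘(ℝ, E) (extChartAt 𝓘(ℝ, E) p).symm y :=
    mdifferentiableOn_extChartAt_symm.mdifferentiableAt
      ((isOpen_extChartAt_target p).mem_nhds hz.2)
  have hΦ' : mfderiv 𝓘(ℝ, ℝ × E) (𝓘(ℝ, ℝ).prod 𝓘(ℝ, E))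
      (Prod.map (extChartAt 𝓘(ℝ, ℝ) t).symm (extChartAt 𝓘(ℝ, E) p).symm) (s, y)
      = (mfderiv 𝓘(ℝ, ℝ) 𝓘(ℝ, ℝ) (extChartAt 𝓘(ℝ, ℝ) t).symm s).prodMap
        (mfderiv 𝓘(ℝ, E) 𝓘(ℝ, E) (extChartAt 𝓘(ℝ, E) p).symm y) := by
    rw [modelWithCornersSelf_prod, ← chartedSpaceSelf_prod]
    exact mfderiv_prodMap h1 h2
  have hI := coordExpr_minusDtSq I t hz.1
  refine ContinuousLinearMap.ext fun a => ContinuousLinearMap.ext fun b => ?_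
  rw [coordExpr_apply, hΦ, hΦ', CoordGeom.lorentzWarped_apply, ← mul_neg, ← hI, ← congrArg σ (coe_extChartAt_opens_symm I t hz.1)]
  exact doublyWarped_apply 𝓘(ℝ, ℝ) 𝓘(ℝ, E) (minusDtSq I) g (fun t : I => σ t) f _ _ _

end Spacetime

/-- In a Ricci-symmetric doubly warped space-time `_f I ×_σ M`, the Riemannian manifold `M` of
dimension `n` is Ricci-symmetric if and only if
`(D_W 𝓕)(U, V) = 2 σ^◇ / f³ W(f) g(U, V) + (n - 1) σ̇² / f³ (g(W, V) U(f) + g(W, U) V(f))`,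
where `𝓕 = (1 / f) H^f` and `σ^◇` is taken with respect to `-dt²` on `I`.  The tensor equation on
`I × M` is written in the charts of `M`. -/
theorem mainTheorem8 {E : Type*} [NormedAddCommGroup E] [NormedSpace ℝ E] [FiniteDimensional ℝ E]
    {M : Type*} [TopologicalSpace M] [ChartedSpace E M] [IsManifold 𝓘(ℝ, E) ∞ M]
    (g : Bundle.ContMDiffRiemannianMetric 𝓘(ℝ, E) ∞ E (fun x : M => TangentSpace 𝓘(ℝ, E) x))
    (f : M → ℝ) (hf : ContMDiff 𝓘(ℝ, E) 𝓘(ℝ, ℝ) ∞ f) (hf_pos : ∀ x, 0 < f x)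
    (I : TopologicalSpace.Opens ℝ) (hI : IsConnected (I : Set ℝ))
    (σ : ℝ → ℝ) (hσ : ContDiffOn ℝ ∞ σ I) (hσ_pos : ∀ t ∈ I, 0 < σ t)
    (hP : IsRicciSymmetric (𝓘(ℝ, ℝ).prod 𝓘(ℝ, E)) (doublyWarpedSpacetime I σ g.inner f)) :
    IsRicciSymmetric 𝓘(ℝ, E) g.inner ↔
      ∀ (t : I) (p : M), ∀ y ∈ (extChartAt 𝓘(ℝ, E) p).target, ∀ W U V : E,
        CoordGeom.covDeriv (coordExpr 𝓘(ℝ, E) g.inner p)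
            (CoordGeom.warpHessian 1 (coordExpr 𝓘(ℝ, E) g.inner p) (coordFun 𝓘(ℝ, E) f p)) y W U V
          = 2 * (warpDiamond 𝓘(ℝ, ℝ) (Module.finrank ℝ E) (minusDtSq I) (fun s : I => σ s) t
                / coordFun 𝓘(ℝ, E) f p y ^ 3)
              * fderiv ℝ (coordFun 𝓘(ℝ, E) f p) y W * coordExpr 𝓘(ℝ, E) g.inner p y U V
            + ((Module.finrank ℝ E : ℝ) - 1) * deriv σ t ^ 2 / coordFun 𝓘(ℝ, E) f p y ^ 3
              * (coordExpr 𝓘(ℝ, E) g.inner p y W V * fderiv ℝ (coordFun 𝓘(ℝ, E) f p) y U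
                + coordExpr 𝓘(ℝ, E) g.inner p y W U * fderiv ℝ (coordFun 𝓘(ℝ, E) f p) y V) := by

  have : IsManifold 𝓘(ℝ, E) 1 M := IsManifold.of_le (n := ∞) (by simp)
  have hW : ∀ p : M, CoordGeom.IsWarpedOn σ I (coordFun 𝓘(ℝ, E) f p)
      (coordExpr 𝓘(ℝ, E) g.inner p) (extChartAt 𝓘(ℝ, E) p).target := fun p =>
    { isOpen_fst := I.isOpen
      contDiffOn_fst := hσ
      ne_zero_fst := fun s hs => (hσ_pos s hs).ne'
      isMetricOn := isMetricOn_coordExpr g p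
      contDiffOn_snd := contDiffOn_coordFun hf p
      ne_zero_snd := fun y _ => (hf_pos _).ne' }
  have hR : ∀ p : M, ∀ s ∈ (I : Set ℝ), ∀ y ∈ (extChartAt 𝓘(ℝ, E) p).target, ∀ w u v : ℝ × E,
      CoordGeom.covDeriv
        (CoordGeom.lorentzWarped σ (coordFun 𝓘(ℝ, E) f p) (coordExpr 𝓘(ℝ, E) g.inner p))
        (CoordGeom.ricci
          (CoordGeom.lorentzWarped σ (coordFun 𝓘(ℝ, E) f p) (coordExpr 𝓘(ℝ, E) g.inner p)))
        (s, y) w u v = 0 := by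
    intro p s hs y hy w u v
    have e : coordExpr (𝓘(ℝ, ℝ).prod 𝓘(ℝ, E)) (doublyWarpedSpacetime I σ g.inner f) (⟨s, hs⟩, p)
        =ᶠ[nhds (s, y)]
        CoordGeom.lorentzWarped σ (coordFun 𝓘(ℝ, E) f p) (coordExpr 𝓘(ℝ, E) g.inner p) := by
      filter_upwards [(hW p).mem_nhds hs hy] with z hz
        using coordExpr_doublyWarpedSpacetime I σ g.inner f ⟨s, hs⟩ p hz
    rw [← CoordGeom.covDeriv_congr e (CoordGeom.ricci_congr e)]
    exact hP (⟨s, hs⟩, p) (s, y) (by rw [extChartAt_spacetime_target]; exact ⟨hs, hy⟩) w u v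
  simp only [warpDiamond_minusDtSq I _ hσ]
  have hspace := fun (p : M) (s : I) y hy w u v =>
    ((hW p).covDeriv_ricci_space (s := s) (y := y) s.2 hy w u v).symm.trans (hR p s s.2 y hy _ _ _)
  -- The dichotomy: is `(n - 1) σ̇ df` nonzero somewhere?
  by_cases hc : ∃ (t : I) (p : M), ∃ y ∈ (extChartAt 𝓘(ℝ, E) p).target,
      (Module.finrank ℝ E : ℝ) - 1 ≠ 0 ∧ deriv σ t ≠ 0 ∧ fderiv ℝ (coordFun 𝓘(ℝ, E) f p) y ≠ 0
  · obtain ⟨t, p, y, hy, hn, hd, hφ⟩ := hc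
    have hn2 : 2 ≤ Module.finrank ℝ E := by
      have h1 : Module.finrank ℝ E ≠ 1 := fun h1 => hn (by rw [h1]; simp)
      -- A nonzero differential excludes dimension zero.
      have h0 : Module.finrank ℝ E ≠ 0 := fun h0 => hφ (by
        have := Module.finrank_zero_iff.1 h0
        ext u
        rw [Subsingleton.elim u 0, map_zero, map_zero])
      omega
    obtain ⟨w, u, hu, hne⟩ := (hW p).exists_covDeriv_warpHessian_ne
      (fun y hy u hu => coordExpr_pos g p hy hu) (hR p) hn2 t.2 hy hφ hd
    -- Both sides of the equivalence are refuted: on the vectors `w, u, u` each would yield the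
    -- equality that `hne` denies.
    constructor
    · intro hM
      refine absurd ?_ hne
      have h1 := hspace p t y hy w u u
      rw [hM p y hy, hu] at h1
      linarith
    · intro hF
      refine absurd ?_ hne
      rw [hF t p y hy, hu]
      ring
  · push Not at hc
    -- The term with the disputed sign vanishes identically, so the spatial identity is the required
    -- equation plus `D Ric`.
    have hzero : ∀ (t : I) (p : M), ∀ y ∈ (extChartAt 𝓘(ℝ, E) p).target, ∀ (c : ℝ) (w u v : E),
        ((Module.finrank ℝ E : ℝ) - 1) * deriv σ t ^ 2 / c
          * (coordExpr 𝓘(ℝ, E) g.inner p y w v * fderiv ℝ (coordFun 𝓘(ℝ, E) f p) y u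
            + coordExpr 𝓘(ℝ, E) g.inner p y w u * fderiv ℝ (coordFun 𝓘(ℝ, E) f p) y v) = 0 := by
      intro t p y hy c w u v
      by_cases hn : (Module.finrank ℝ E : ℝ) - 1 = 0
      · simp [hn]
      by_cases hd : deriv σ t = 0
      · simp [hd]
      simp [hc t p y hy hn hd]
    constructor
    · intro hM t p y hy w u v
      have h1 := hspace p t y hy w u v
      rw [hM p y hy, hzero t p y hy] at h1
      rw [hzero t p y hy]
      linarith
    · intro hF p y hy w u v
      -- Ricci-symmetry of M does not involve time, so any single instant suffices.
      obtain ⟨s, hs⟩ := hI.nonempty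
      have h1 := hspace p ⟨s, hs⟩ y hy w u v
      rw [hF ⟨s, hs⟩ p y hy, hzero ⟨s, hs⟩ p y hy] at h1
      linarith
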